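/- Let $A\in\mathbb R^{n\times n}$, $B\in\mathbb R^{n\times m}$, $C\in\mathbb R^{p\times n}$ and let $F\in\mathbb R^{r\times n}$ have full row rank; consider the system $\dot x=Ax+Bu$, $y=Cx$, $z=Fx$ on $[0,\infty)$. For a matrix $M$ with $n$ columns let $\mathcal O_{(A,M)}$ be the matrix with blocks $M,MA,\dots,MA^{n-1}$ stacked, and let $\mathcal V_F=\operatorname{Im}\mathcal O_{(A,F)}^{\mathsf T}=\operatorname{Im}\begin{pmatrix}F^{\mathsf T}&A^{\mathsf T}F^{\mathsf T}&\cdots&(A^{\mathsf T})^{n-1}F^{\mathsf T}\end{pmatrix}$. For $\bar F\in\mathbb R^{d\times n}$ the *controller rank conditions* are $$\operatorname{rank}\begin{pmatrix}\bar FA\\ \bar F\end{pmatrix}=\operatorname{rank}\bar F,\qquad \operatorname{rank}\begin{pmatrix}\lambda\bar F-\bar FA&\bar FB\end{pmatrix}=\operatorname{rank}\bar F\quad\forall\lambda\in\mathbb C ,$$ and for a matrix $R$ with $n$ columns the *observer rank conditions* are $$\operatorname{rank}\begin{pmatrix}FA\\RA\\CA\\C\\F\\R\end{pmatrix}=\operatorname{rank}\begin{pmatrix}CA\\C\\F\\R\end{pmatrix},\qquad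 \operatorname{rank}\begin{pmatrix}\lambda F-FA\\ \lambda R-RA\\CA\\C\end{pmatrix}=\operatorname{rank}\begin{pmatrix}CA\\C\\F\\R\end{pmatrix}\quad\forall\lambda\in\mathbb C .$$ Suppose that 1. $(A,B,F^{\mathsf T})$ is intrinsically functionally controllable: there are $d\in\{r,\dots,n\}$ and $R_1\in\mathbb R^{(d-r)\times n}$ such that $\bar F=\begin{pmatrix}F\\R_1\end{pmatrix}$ has rank $d$ and satisfies the controller rank conditions; and 2. $(A,C,F)$ is functionally observable: $\operatorname{rank}\begin{pmatrix}\mathcal O_{(A,C)}\\ \mathcal O_{(A,F)}\end{pmatrix}=\operatorname{rank}\mathcal O_{(A,C)}$. Then there are matrices $R_1,R_2$ (possibly empty), with $r$ plus their numbers of rows at most $n$, such that $\bar F=\begin{pmatrix}F\\R_1\end{pmatrix}$ has full row rank and satisfies the controller rank conditions and $R=\begin{pmatrix}R_1\\R_2\end{pmatrix}$ satisfies the observer rank conditions. Explicitly: (a) Rows of $\mathcal O_{(A,F)}$ can be selected that together with the rows of $F$ form a basis of the row space of $\mathcal O_{(A,F)}$. For every such selection $R_1$, the matrix $\bar F=\begin{pmatrix}F\\R_1\end{pmatrix}$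 has full row rank $d=\dim\mathcal V_F$, $\operatorname{Im}\bar F^{\mathsf T}=\mathcal V_F$, and $\bar F$ satisfies the controller rank conditions. (b) There is an invertible $T$ with $$T^{-1}AT=\begin{pmatrix}A_o&0\\A_{21}&A_u\end{pmatrix},\qquad CT=\begin{pmatrix}C_o&0\end{pmatrix},\qquad A_o\in\mathbb R^{h\times h},\ (A_o,C_o)\text{ observable}.$$ For every such $T$ and every $R_1$ as in (a), $\bar FT=\begin{pmatrix}\bar F_o&0\end{pmatrix}$ with $\bar F_o\in\mathbb R^{d\times h}$ of rank $d$, and there is a matrix $\bar F_o^{\perp}$ whose rows complete those of $\bar F_o$ to a basis of $\mathbb R^h$. For every such $\bar F_o^{\perp}$, with $R_2=\begin{pmatrix}\bar F_o^{\perp}&0\end{pmatrix}T^{-1}$, the matrix $R=\begin{pmatrix}R_1\\R_2\end{pmatrix}$ satisfies the observer rank conditions, and there is a functional observer of $\bar Fx$ whose order $q$ is the number of rows of $\begin{pmatrix}F\\R_1\\R_2\end{pmatrix}$. Here a functional observer of $\bar Fx$ of order $q$ is a system $\dot w=Nw+Jy+Hu$ with $w(t)\in\mathbb R^q$ and output $\hat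 z=Dw+Ey\in\mathbb R^d$ such that $\hat z(t)-\bar Fx(t)\to0$ as $t\to\infty$ for every continuous input and all initial conditions $x(0),w(0)$; so the first $r$ components of $\hat z$ estimate $z=Fx$. In (b), $N,J,D,E$ and a matrix $P$ can be chosen independently of $B$, with $H=PB$. (c) For every $R_1$ as in (a) there is a gain $K\in\mathbb R^{m\times d}$ for which $u=-K\bar Fx$ drives $\bar Fx(t)\to0$ from every initial condition (a condition that involves only $A,B,\bar F$). The controller and the observer can be designed independently: for every such $K$ and every functional observer of $\bar Fx$ (of any order), the closed loop with the static law $u=-K\hat z$ has a solution on $[0,\infty)$ for all initial conditions $x(0),w(0)$, and every solution satisfies $z(t)=Fx(t)\to0$ as $t\to\infty$. -/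

import Mathlib

open Matrix Filter Topology

namespace GSP

/-- The controllability matrix `(B, A B, …, A^(n-1) B)`; the column `(k, j)` is the `j`-th
column of `A^k B`. -/
def ctrbMatrix {n m : ℕ} (A : Matrix (Fin n) (Fin n) ℝ) (B : Matrix (Fin n) (Fin m) ℝ) :
    Matrix (Fin n) (Fin n × Fin m) ℝ :=
  Matrix.of fun i kj => (A ^ (kj.1 : ℕ) * B) i kj.2

/-- The observability matrix `(C; C A; …; C A^(n-1))`; the row `(k, i)` is the `i`-th
row of `C A^k`. -/
def obsMatrix {n p : ℕ} (A : Matrix (Fin n) (Fin n) ℝ) (C : Matrix (Fin p) (Fin n) ℝ) :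
    Matrix (Fin n × Fin p) (Fin n) ℝ :=
  Matrix.of fun ki j => (C * A ^ (ki.1 : ℕ)) ki.2 j

/-- The intrinsic functional subspace: the image of the controllability matrix of the pair
`(Aᵀ, Fᵀ)`. -/
def intrinsicSubspace {n r : ℕ} (A : Matrix (Fin n) (Fin n) ℝ) (F : Matrix (Fin r) (Fin n) ℝ) :
    Submodule ℝ (Fin n → ℝ) :=
  LinearMap.range (ctrbMatrix Aᵀ Fᵀ).mulVecLin

/-- The two controller rank conditions for a completed functional `Fb`:
`rank (Fb A; Fb) = rank Fb`, and `rank (s Fb - Fb A, Fb B) = rank Fb` for all complex `s`. -/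
def ControllerRankConditions {n m : ℕ} {ι : Type} (A : Matrix (Fin n) (Fin n) ℝ)
    (B : Matrix (Fin n) (Fin m) ℝ) (Fb : Matrix ι (Fin n) ℝ) : Prop :=
  (fromRows (Fb * A) Fb).rank = Fb.rank ∧
  ∀ s : ℂ,
    (fromCols (s • Fb.map Complex.ofReal - (Fb * A).map Complex.ofReal)
      ((Fb * B).map Complex.ofReal)).rank = Fb.rank

/-- Intrinsic functional controllability of `(A, B, Fᵀ)`: the functional `F` has a completion
`(F; R₁)` with `d = r + k ≤ n` rows, of full row rank, that satisfies the controller rank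
conditions. -/
def IsIntrinsicallyFunctionallyControllable {n m r : ℕ} (A : Matrix (Fin n) (Fin n) ℝ)
    (B : Matrix (Fin n) (Fin m) ℝ) (F : Matrix (Fin r) (Fin n) ℝ) : Prop :=
  ∃ (k : ℕ) (R₁ : Matrix (Fin k) (Fin n) ℝ), r + k ≤ n ∧ (fromRows F R₁).rank = r + k ∧
    ControllerRankConditions A B (fromRows F R₁)

/-- Functional observability of `(A, C, F)`: stacking the observability matrix of `(A, F)` under
that of `(A, C)` does not increase the rank. -/
def IsFunctionallyObservable {n p r : ℕ} (A : Matrix (Fin n) (Fin n) ℝ)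
    (C : Matrix (Fin p) (Fin n) ℝ) (F : Matrix (Fin r) (Fin n) ℝ) : Prop :=
  (fromRows (obsMatrix A C) (obsMatrix A F)).rank = (obsMatrix A C).rank

/-- The two observer rank conditions for the functional `F` augmented by the rows of `R`:
`rank (F A; R A; C A; C; F; R) = rank (C A; C; F; R)`, and
`rank (s F - F A; s R - R A; C A; C) = rank (C A; C; F; R)` for all complex `s`. -/
def ObserverRankConditions {n p r : ℕ} {ι : Type} (A : Matrix (Fin n) (Fin n) ℝ)
    (C : Matrix (Fin p) (Fin n) ℝ) (F : Matrix (Fin r) (Fin n) ℝ)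
    (R : Matrix ι (Fin n) ℝ) : Prop :=
  (fromRows (F * A) (fromRows (R * A) (fromRows (C * A) (fromRows C (fromRows F R))))).rank =
      (fromRows (C * A) (fromRows C (fromRows F R))).rank ∧
  ∀ s : ℂ,
    (fromRows (s • F.map Complex.ofReal - (F * A).map Complex.ofReal)
      (fromRows (s • R.map Complex.ofReal - (R * A).map Complex.ofReal)
        (fromRows ((C * A).map Complex.ofReal) (C.map Complex.ofReal)))).rank =
      (fromRows (C * A) (fromRows C (fromRows F R))).rank

/-- The rows of `M` form a basis of the subspace `V`. -/
def RowsFormBasis {n : ℕ} {ι : Type} (M : Matrix ι (Fin n) ℝ)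
    (V : Submodule ℝ (Fin n → ℝ)) : Prop :=
  LinearIndependent ℝ M.row ∧ Submodule.span ℝ (Set.range M.row) = V

/-- `R₁` consists of rows selected from the observability matrix of `(A, F)`, which together with
the rows of `F` form a basis of the row space of that observability matrix. -/
def IsRowBasisCompletion {n r k : ℕ} (A : Matrix (Fin n) (Fin n) ℝ)
    (F : Matrix (Fin r) (Fin n) ℝ) (R₁ : Matrix (Fin k) (Fin n) ℝ) : Prop :=
  (∃ σ : Fin k → Fin n × Fin r, R₁ = (obsMatrix A F).submatrix σ id) ∧
  RowsFormBasis (fromRows F R₁) (Submodule.span ℝ (Set.range (obsMatrix A F).row))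

/-- Kalman observability decomposition: `T` is invertible with inverse `S`,
`S A T = (Ao, 0; A₂₁, Au)`, `C T = (Co, 0)`, and the pair `(Ao, Co)` is observable. -/
structure IsKalmanObsDecomposition {n p h l : ℕ} (A : Matrix (Fin n) (Fin n) ℝ)
    (C : Matrix (Fin p) (Fin n) ℝ) (T : Matrix (Fin n) (Fin h ⊕ Fin l) ℝ)
    (S : Matrix (Fin h ⊕ Fin l) (Fin n) ℝ) (Ao : Matrix (Fin h) (Fin h) ℝ)
    (A₂₁ : Matrix (Fin l) (Fin h) ℝ) (Au : Matrix (Fin l) (Fin l) ℝ)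
    (Co : Matrix (Fin p) (Fin h) ℝ) : Prop where
  mul_inv : T * S = 1
  inv_mul : S * T = 1
  state : S * A * T = fromBlocks Ao 0 A₂₁ Au
  output : C * T = fromCols Co 0
  observable : (obsMatrix Ao Co).rank = h

/-- `x` is a solution on `[0, ∞)` of `x' = A x + B u`. -/
def IsTrajectory {n m : ℕ} (A : Matrix (Fin n) (Fin n) ℝ) (B : Matrix (Fin n) (Fin m) ℝ)
    (u : ℝ → Fin m → ℝ) (x : ℝ → Fin n → ℝ) : Prop :=
  ∀ t, 0 ≤ t → HasDerivWithinAt x (A *ᵥ x t + B *ᵥ u t) (Set.Ici 0) t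

/-- A linear observer of order `q`, driven by the output `y` and the input `u`:
`w' = N w + J y + H u`, with estimate `D w + E y`. -/
structure LinearObserver (q p m : ℕ) (ι : Type) where
  N : Matrix (Fin q) (Fin q) ℝ
  J : Matrix (Fin q) (Fin p) ℝ
  H : Matrix (Fin q) (Fin m) ℝ
  D : Matrix ι (Fin q) ℝ
  E : Matrix ι (Fin p) ℝ

/-- The estimate `D w + E y` that the observer produces. -/
def LinearObserver.estimate {q p m : ℕ} {ι : Type} (O : LinearObserver q p m ι)
    (w : Fin q → ℝ) (y : Fin p → ℝ) : ι → ℝ :=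
  O.D *ᵥ w + O.E *ᵥ y

/-- `w` is a solution on `[0, ∞)` of the observer equation `w' = N w + J y + H u`. -/
def LinearObserver.IsRun {q p m : ℕ} {ι : Type} (O : LinearObserver q p m ι)
    (y : ℝ → Fin p → ℝ) (u : ℝ → Fin m → ℝ) (w : ℝ → Fin q → ℝ) : Prop :=
  ∀ t, 0 ≤ t →
    HasDerivWithinAt w (O.N *ᵥ w t + O.J *ᵥ y t + O.H *ᵥ u t) (Set.Ici 0) t

/-- `O` is a functional observer of `G x` for the system `x' = A x + B u`, `y = C x`: for every
input, every initial state of the system and every initial state of the observer, the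
estimation error tends to zero. -/
def IsFunctionalObserver {n m p q : ℕ} {ι : Type} (A : Matrix (Fin n) (Fin n) ℝ)
    (B : Matrix (Fin n) (Fin m) ℝ) (C : Matrix (Fin p) (Fin n) ℝ) (G : Matrix ι (Fin n) ℝ)
    (O : LinearObserver q p m ι) : Prop :=
  ∀ (u : ℝ → Fin m → ℝ) (x : ℝ → Fin n → ℝ) (w : ℝ → Fin q → ℝ),
    ContinuousOn u (Set.Ici 0) → IsTrajectory A B u x → O.IsRun (fun t => C *ᵥ x t) u w →
    Tendsto (fun t => O.estimate (w t) (C *ᵥ x t) - G *ᵥ x t) atTop (𝓝 0)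

/-- `K` is the gain of a functional controller of `G x` for `x' = A x + B u`: the static
functional state feedback `u = -K G x` drives `G x` to zero from every initial state. -/
def IsFunctionalController {n m : ℕ} {ι : Type} [Fintype ι] (A : Matrix (Fin n) (Fin n) ℝ)
    (B : Matrix (Fin n) (Fin m) ℝ) (G : Matrix ι (Fin n) ℝ) (K : Matrix (Fin m) ι ℝ) : Prop :=
  ∀ x : ℝ → Fin n → ℝ, IsTrajectory A B (fun t => -(K *ᵥ (G *ᵥ x t))) x →
    Tendsto (fun t => G *ᵥ x t) atTop (𝓝 0)

/-- `(x, w)` is a solution on `[0, ∞)` of the closed loop formed by the system `x' = A x + B u`,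
`y = C x`, the observer `O`, and the static law `u = -K ẑ`, where `ẑ` is the estimate that the
observer produces. -/
def IsClosedLoopSolution {n m p q : ℕ} {ι : Type} [Fintype ι] (A : Matrix (Fin n) (Fin n) ℝ)
    (B : Matrix (Fin n) (Fin m) ℝ) (C : Matrix (Fin p) (Fin n) ℝ) (K : Matrix (Fin m) ι ℝ)
    (O : LinearObserver q p m ι) (x : ℝ → Fin n → ℝ) (w : ℝ → Fin q → ℝ) : Prop :=
  IsTrajectory A B (fun t => -(K *ᵥ O.estimate (w t) (C *ᵥ x t))) x ∧
  O.IsRun (fun t => C *ᵥ x t) (fun t => -(K *ᵥ O.estimate (w t) (C *ᵥ x t))) w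

end GSP

open GSP

/-!
All rank conditions are translated into statements about the unobservable subspace. If
`Fb * A = M * Fb` with `Fb` of full row rank, the controller rank conditions are the Hautus test for
controllability of the quotient pair `(M, Fb * B)`. The row space of `obsMatrix A F` is the smallest
`A`-invariant space of row vectors containing the rows of `F`, so a basis `Fb` of it factors through
any completion of `F` that witnesses intrinsic functional controllability, and controllability of
the larger quotient passes to the smaller one. Functional observability says that `Fb` vanishes on
the unobservable subspace of `(A, C)`, so `Fb` lives on the observable quotient, where a Luenberger
observer reconstructs the full quotient state.

Gains come from Gramians: the Gramian of `(-(A + 1), C)` is a Lyapunov matrix for a suitable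
`A - L * C`, and controllers are obtained by duality. Conversely, since `Fb` is onto, any functional
controller makes `M - Fb * B * K` asymptotically stable, which yields a Lyapunov matrix for it. In
the closed loop `ζ = Fb * x` satisfies `ζ' = (M - Fb * B * K) * ζ + b`, with `b` a multiple of the
estimation error, and a system with a Lyapunov matrix, driven by an input tending to zero, tends to
zero.
-/

namespace GSP

section Rank

variable {K ι κ l : Type*} [Field K]

theorem linearIndependent_row_iff_vecMul [Fintype ι] {M : Matrix ι l K} :
    LinearIndependent K M.row ↔ ∀ v, v ᵥ* M = 0 → v = 0 := by
  rw [← vecMul_injective_iff]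
  exact injective_iff_map_eq_zero M.vecMulLinear

theorem exists_eq_mul_iff_span_row_le [Fintype κ] {M : Matrix ι l K} {P : Matrix κ l K} :
    (∃ L : Matrix ι κ K, M = L * P) ↔
      Submodule.span K (Set.range M.row) ≤ Submodule.span K (Set.range P.row) := by
  have hrow (L : Matrix ι κ K) (i : ι) : (L * P).row i = ∑ j, L i j • P.row j :=
    (mul_apply_eq_vecMul L P i).trans (vecMul_eq_sum _ _)
  simp only [Submodule.span_le, Set.range_subset_iff, SetLike.mem_coe,
    Submodule.mem_span_range_iff_exists_fun]
  refine ⟨fun ⟨L, hL⟩ i => ⟨L i, hL ▸ (hrow L i).symm⟩, fun h => ?_⟩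
  choose L hL using h
  exact ⟨L, funext fun i => (hL i).symm.trans (hrow L i).symm⟩

variable [Fintype l]

theorem fromRows_mulVec_eq_zero_iff {M : Matrix ι l K} {P : Matrix κ l K} {v : l → K} :
    fromRows M P *ᵥ v = 0 ↔ M *ᵥ v = 0 ∧ P *ᵥ v = 0 := by
  rw [fromRows_mulVec, ← Sum.elim_zero_zero, Sum.elim_eq_iff]

theorem rank_eq_card_iff_linearIndependent_row [Fintype ι] {M : Matrix ι l K} :
    M.rank = Fintype.card ι ↔ LinearIndependent K M.row := by
  rw [linearIndependent_iff_card_eq_finrank_span, eq_comm, rank_eq_finrank_span_row]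
  rfl

theorem rank_eq_card_iff_mulVec [Finite ι] {M : Matrix ι l K} :
    M.rank = Fintype.card l ↔ ∀ v, M *ᵥ v = 0 → v = 0 := by
  have := Fintype.ofFinite ι
  rw [← rank_transpose, rank_eq_card_iff_linearIndependent_row, linearIndependent_row_iff_vecMul]
  simp only [vecMul_transpose]

theorem rank_mul_eq_left_of_mul_eq_one [Fintype κ] [DecidableEq κ] (Y : Matrix ι κ K)
    {Z : Matrix κ l K} {W : Matrix l κ K} (hZ : Z * W = 1) : (Y * Z).rank = Y.rank :=
  (rank_mul_le_left Y Z).antisymm <| by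
    simpa only [Matrix.mul_assoc, hZ, Matrix.mul_one] using rank_mul_le_left (Y * Z) W

theorem rank_fromRows_eq_right_iff [Finite ι] [Fintype κ] {M : Matrix ι l K} {P : Matrix κ l K} :
    (fromRows M P).rank = P.rank ↔ ∃ L : Matrix ι κ K, M = L * P := by
  have := Fintype.ofFinite ι
  have hrange : Set.range (fromRows M P).row = Set.range M.row ∪ Set.range P.row :=
    Set.Sum.elim_range M.row P.row
  rw [exists_eq_mul_iff_span_row_le, rank_eq_finrank_span_row, rank_eq_finrank_span_row, hrange,
    Submodule.span_union, ← sup_eq_right]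
  exact ⟨fun h => (Submodule.eq_of_le_of_finrank_eq le_sup_right h.symm).symm,
    fun h => congrArg (fun U : Submodule K (l → K) => Module.finrank K U) h⟩

theorem rank_fromRows_eq_left_iff [Fintype ι] [Finite κ] {M : Matrix ι l K} {P : Matrix κ l K} :
    (fromRows M P).rank = M.rank ↔ ∃ L : Matrix κ ι K, P = L * M := by
  have := Fintype.ofFinite κ
  have hswap : (fromRows M P).submatrix (Equiv.sumComm κ ι) (Equiv.refl l) = fromRows P M := by
    ext (i | i) j <;> rfl
  rw [← rank_fromRows_eq_right_iff, ← hswap, rank_submatrix]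

end Rank

section UnobservableSubspace

variable {K ι κ l : Type*} [Field K] [Fintype ι] [DecidableEq ι] [Fintype l] [DecidableEq l]

theorem mul_pow_eq_pow_mul {P : Matrix l ι K} {A : Matrix ι ι K} {M : Matrix l l K}
    (h : P * A = M * P) (k : ℕ) : P * A ^ k = M ^ k * P := by
  induction k with
  | zero => simp only [pow_zero, Matrix.mul_one, Matrix.one_mul]
  | succ k ih => rw [pow_succ, ← Matrix.mul_assoc, ih, Matrix.mul_assoc, h, ← Matrix.mul_assoc,
      ← pow_succ]

/-- The unobservable subspace of the pair `(A, C)`: the states `v` with `C A ^ k v = 0` for every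
`k`. The pair is observable when this subspace is trivial; dually, `(A, B)` is controllable when
the unobservable subspace of `(Aᵀ, Bᵀ)` is trivial. -/
def unobservableSubspace (A : Matrix ι ι K) (C : Matrix κ ι K) : Submodule K (ι → K) :=
  ⨅ k : ℕ, LinearMap.ker (C * A ^ k).mulVecLin

variable {A : Matrix ι ι K} {C : Matrix κ ι K} {v : ι → K}

theorem mem_unobservableSubspace :
    v ∈ unobservableSubspace A C ↔ ∀ k : ℕ, (C * A ^ k) *ᵥ v = 0 := by
  simp only [unobservableSubspace, Submodule.mem_iInf, LinearMap.mem_ker, mulVecLin_apply]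

theorem mulVec_eq_zero_of_mem_unobservableSubspace (hv : v ∈ unobservableSubspace A C) :
    C *ᵥ v = 0 := by
  simpa using mem_unobservableSubspace.1 hv 0

theorem mulVec_mem_unobservableSubspace (hv : v ∈ unobservableSubspace A C) :
    A *ᵥ v ∈ unobservableSubspace A C := by
  rw [mem_unobservableSubspace] at hv ⊢
  intro k
  rw [mulVec_mulVec, Matrix.mul_assoc, ← pow_succ]
  exact hv (k + 1)

theorem le_unobservableSubspace {U : Submodule K (ι → K)} (hC : ∀ v ∈ U, C *ᵥ v = 0)
    (hA : ∀ v ∈ U, A *ᵥ v ∈ U) : U ≤ unobservableSubspace A C := by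
  intro v hv
  rw [mem_unobservableSubspace]
  intro k
  induction k generalizing v with
  | zero => simpa only [pow_zero, Matrix.mul_one] using hC v hv
  | succ k ih => rw [pow_succ, ← Matrix.mul_assoc, ← mulVec_mulVec]; exact ih (hA v hv)

theorem mem_unobservableSubspace_mul_iff {Ao : Matrix l l K} {Co : Matrix κ l K}
    {Z : Matrix l ι K} (hZ : Z * A = Ao * Z) :
    v ∈ unobservableSubspace A (Co * Z) ↔ Z *ᵥ v ∈ unobservableSubspace Ao Co := by
  simp only [mem_unobservableSubspace, Matrix.mul_assoc, mul_pow_eq_pow_mul hZ]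
  simp only [← Matrix.mul_assoc, mulVec_mulVec]

/-- The Hautus test: over an algebraically closed field, a nonzero unobservable subspace contains
an eigenvector because it is invariant. -/
theorem unobservableSubspace_eq_bot_iff_hautus [IsAlgClosed K] :
    unobservableSubspace A C = ⊥ ↔ ∀ (s : K) v, A *ᵥ v = s • v → C *ᵥ v = 0 → v = 0 := by
  constructor
  · intro h s v hA hC
    have hpow (k : ℕ) : A ^ k *ᵥ v = s ^ k • v := by
      induction k with
      | zero => simp only [pow_zero, one_mulVec, one_smul]
      | succ k ih => rw [pow_succ, ← mulVec_mulVec, hA, mulVec_smul, ih, smul_smul, pow_succ']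
    rw [← Submodule.mem_bot K, ← h, mem_unobservableSubspace]
    intro k
    rw [← mulVec_mulVec, hpow, mulVec_smul, hC, smul_zero]
  · intro h
    by_contra hne
    have : Nontrivial (unobservableSubspace A C) := Submodule.nontrivial_iff_ne_bot.2 hne
    have hinv : ∀ v ∈ unobservableSubspace A C, A.mulVecLin v ∈ unobservableSubspace A C :=
      fun _ => mulVec_mem_unobservableSubspace
    obtain ⟨s, hs⟩ := Module.End.exists_eigenvalue (A.mulVecLin.restrict hinv)
    obtain ⟨v, hv⟩ := hs.exists_hasEigenvector
    exact hv.2 (Subtype.ext (h s v (congrArg Subtype.val hv.apply_eq_smul)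
      (mulVec_eq_zero_of_mem_unobservableSubspace v.2)))

end UnobservableSubspace

section Complexification

variable {ι κ l : Type*} [Fintype ι]

theorem map_ofReal_mul (M : Matrix κ ι ℝ) (P : Matrix ι l ℝ) :
    (M * P).map Complex.ofReal = M.map Complex.ofReal * P.map Complex.ofReal :=
  Matrix.map_mul (f := Complex.ofRealHom)

theorem map_ofReal_mulVec_eq_zero_iff {M : Matrix κ ι ℝ} {v : ι → ℂ} :
    M.map Complex.ofReal *ᵥ v = 0 ↔
      (M *ᵥ fun i => (v i).re) = 0 ∧ (M *ᵥ fun i => (v i).im) = 0 := by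
  simp only [funext_iff, ← forall_and, Complex.ext_iff]
  simp [mulVec, dotProduct]

theorem unobservableSubspace_map_ofReal_eq_bot_iff [DecidableEq ι] {A : Matrix ι ι ℝ}
    {C : Matrix κ ι ℝ} :
    unobservableSubspace (A.map Complex.ofReal) (C.map Complex.ofReal) = ⊥ ↔
      unobservableSubspace A C = ⊥ := by
  have hpow (k : ℕ) : C.map Complex.ofReal * A.map Complex.ofReal ^ k =
      (C * A ^ k).map Complex.ofReal := by
    rw [map_ofReal_mul]
    exact congrArg _ (Matrix.map_pow A Complex.ofRealHom k).symm
  simp only [Submodule.eq_bot_iff, mem_unobservableSubspace, hpow, map_ofReal_mulVec_eq_zero_iff,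
    forall_and]
  refine ⟨fun h v hv => ?_, fun h v ⟨hre, him⟩ => ?_⟩
  · have hv' := h (fun i => (v i : ℂ)) ⟨hv, fun k => mulVec_zero _⟩
    exact funext fun i => Complex.ofReal_injective (congrFun hv' i)
  · exact funext fun i => Complex.ext (congrFun (h _ hre) i) (congrFun (h _ him) i)

end Complexification

section ObservabilityMatrix

variable {n p r : ℕ} {A : Matrix (Fin n) (Fin n) ℝ} {C : Matrix (Fin p) (Fin n) ℝ}
  {F : Matrix (Fin r) (Fin n) ℝ}

theorem pow_mem_span_pow_lt {K : Type*} [Field K] (A : Matrix (Fin n) (Fin n) K) (k : ℕ) :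
    A ^ k ∈ Submodule.span K (Set.range fun i : Fin n => A ^ (i : ℕ)) := by
  rcases Nat.eq_zero_or_pos n with rfl | hn
  · exact Subsingleton.elim 0 (A ^ k) ▸ Submodule.zero_mem _
  have hdeg : (Polynomial.X ^ k %ₘ A.charpoly).natDegree < n := by
    have hcharpoly : A.charpoly.natDegree = n := by
      simpa only [Fintype.card_fin] using A.charpoly_natDegree_eq_dim
    refine (Polynomial.natDegree_modByMonic_lt _ A.charpoly_monic fun h => ?_).trans_eq hcharpoly
    rw [h, Polynomial.natDegree_one] at hcharpoly
    exact hn.ne hcharpoly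
  rw [pow_eq_aeval_mod_charpoly, Polynomial.aeval_eq_sum_range' hdeg, Finset.sum_range]
  exact Submodule.sum_mem _ fun i _ => Submodule.smul_mem _ _ (Submodule.subset_span ⟨i, rfl⟩)

theorem intrinsicSubspace_eq_span_row :
    intrinsicSubspace A F = Submodule.span ℝ (Set.range (obsMatrix A F).row) := by
  have htranspose : ctrbMatrix Aᵀ Fᵀ = (obsMatrix A F)ᵀ := by
    ext i kj
    simp only [ctrbMatrix, obsMatrix, ← transpose_pow, ← transpose_mul, of_apply, transpose_apply]
  rw [intrinsicSubspace, htranspose, range_mulVecLin]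
  rfl

theorem row_mul_pow_mem_intrinsicSubspace (k : ℕ) (i : Fin r) :
    (F * A ^ k).row i ∈ intrinsicSubspace A F := by
  have hmem := Submodule.mem_map_of_mem (f := vecMulBilin ℝ ℝ (F i)) (pow_mem_span_pow_lt A k)
  rw [Submodule.map_span] at hmem
  rw [intrinsicSubspace_eq_span_row]
  refine Submodule.span_mono ?_ hmem
  rintro _ ⟨_, ⟨j, rfl⟩, rfl⟩
  exact ⟨(j, i), rfl⟩

theorem vecMul_mem_intrinsicSubspace {v : Fin n → ℝ} (hv : v ∈ intrinsicSubspace A F) :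
    v ᵥ* A ∈ intrinsicSubspace A F := by
  suffices h : intrinsicSubspace A F ≤ (intrinsicSubspace A F).comap A.vecMulLinear from h hv
  conv_lhs => rw [intrinsicSubspace_eq_span_row]
  rw [Submodule.span_le]
  rintro _ ⟨ki, rfl⟩
  have hsucc := row_mul_pow_mem_intrinsicSubspace (A := A) (F := F) (ki.1 + 1) ki.2
  rwa [pow_succ, ← Matrix.mul_assoc] at hsucc

theorem intrinsicSubspace_le {V : Submodule ℝ (Fin n → ℝ)} (hF : ∀ i, F.row i ∈ V)
    (hA : ∀ v ∈ V, v ᵥ* A ∈ V) : intrinsicSubspace A F ≤ V := by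
  rw [intrinsicSubspace_eq_span_row, Submodule.span_le]
  rintro _ ⟨⟨k, i⟩, rfl⟩
  suffices h : ∀ j : ℕ, (F * A ^ j).row i ∈ V from h k
  intro j
  induction j with
  | zero => simpa only [pow_zero, Matrix.mul_one] using hF i
  | succ j ih => rw [pow_succ, ← Matrix.mul_assoc]; exact hA _ ih

theorem obsMatrix_mulVec_eq_zero_iff {v : Fin n → ℝ} :
    obsMatrix A C *ᵥ v = 0 ↔ v ∈ unobservableSubspace A C := by
  rw [mem_unobservableSubspace]
  refine ⟨fun h k => ?_, fun h => funext fun ki => congrFun (h ki.1) ki.2⟩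
  obtain ⟨L, hL⟩ : ∃ L : Matrix (Fin p) (Fin n × Fin p) ℝ, C * A ^ k = L * obsMatrix A C := by
    rw [exists_eq_mul_iff_span_row_le, Submodule.span_le, ← intrinsicSubspace_eq_span_row]
    exact Set.range_subset_iff.2 fun i => row_mul_pow_mem_intrinsicSubspace k i
  rw [hL, ← mulVec_mulVec, h, mulVec_zero]

theorem rank_obsMatrix_eq_iff :
    (obsMatrix A C).rank = n ↔ unobservableSubspace A C = ⊥ := by
  simp only [Submodule.eq_bot_iff, ← obsMatrix_mulVec_eq_zero_iff, ← rank_eq_card_iff_mulVec,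
    Fintype.card_fin]

theorem IsFunctionallyObservable.unobservableSubspace_le (h : IsFunctionallyObservable A C F) :
    unobservableSubspace A C ≤ unobservableSubspace A F := by
  obtain ⟨L, hL⟩ := rank_fromRows_eq_left_iff.1 h
  intro v hv
  rw [← obsMatrix_mulVec_eq_zero_iff] at hv ⊢
  rw [hL, ← mulVec_mulVec, hv, mulVec_zero]

theorem RowsFormBasis.mulVec_eq_zero_of_mem_unobservableSubspace {ι : Type}
    {Fb : Matrix ι (Fin n) ℝ} (hFb : RowsFormBasis Fb (intrinsicSubspace A F)) {v : Fin n → ℝ}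
    (hv : v ∈ unobservableSubspace A F) : Fb *ᵥ v = 0 := by
  obtain ⟨L, hL⟩ : ∃ L : Matrix ι (Fin n × Fin r) ℝ, Fb = L * obsMatrix A F := by
    rw [exists_eq_mul_iff_span_row_le, hFb.2, intrinsicSubspace_eq_span_row]
  rw [hL, ← mulVec_mulVec, obsMatrix_mulVec_eq_zero_iff.2 hv, mulVec_zero]

end ObservabilityMatrix

theorem dotProduct_self_nonneg {ι R : Type*} [Fintype ι] [Ring R] [LinearOrder R]
    [IsStrictOrderedRing R] (v : ι → R) : 0 ≤ v ⬝ᵥ v :=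
  Finset.sum_nonneg fun i _ => mul_self_nonneg (v i)

section Exponential

open scoped Norms.Operator

variable {ι κ : Type*} [Fintype ι] [DecidableEq ι] [Fintype κ]

theorem hasDerivAt_exp_smul_mulVec (A : Matrix ι ι ℝ) (x₀ : ι → ℝ) (t : ℝ) :
    HasDerivAt (fun t : ℝ => NormedSpace.exp (t • A) *ᵥ x₀)
      (A *ᵥ (NormedSpace.exp (t • A) *ᵥ x₀)) t := by
  let eval : Matrix ι ι ℝ →ₗ[ℝ] (ι → ℝ) := (mulVecBilin ℝ ℝ).flip x₀
  rw [mulVec_mulVec]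
  exact (LinearMap.toContinuousLinearMap eval).hasFDerivAt.comp_hasDerivAt t
    (hasDerivAt_exp_smul_const' A t)

theorem mul_exp_eq_exp_mul [DecidableEq κ] {P : Matrix κ ι ℝ} {A : Matrix ι ι ℝ} {M : Matrix κ κ ℝ}
    (h : P * A = M * P) : P * NormedSpace.exp A = NormedSpace.exp M * P := by
  have hA := (NormedSpace.exp_series_hasSum_exp' (𝕂 := ℝ) A).map (addMonoidHomMulLeft P)
    (continuous_const.matrix_mul continuous_id)
  have hM := (NormedSpace.exp_series_hasSum_exp' (𝕂 := ℝ) M).map (addMonoidHomMulRight P)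
    (continuous_id.matrix_mul continuous_const)
  have hterm : (addMonoidHomMulLeft P ∘ fun k : ℕ => ((k.factorial : ℝ)⁻¹) • A ^ k) =
      addMonoidHomMulRight P ∘ fun k : ℕ => ((k.factorial : ℝ)⁻¹) • M ^ k := by
    ext1 k
    simp only [Function.comp_apply, addMonoidHomMulLeft_apply, addMonoidHomMulRight_apply,
      Matrix.mul_smul, Matrix.smul_mul, mul_pow_eq_pow_mul h]
  exact (hterm ▸ hA).unique hM

/-- The finite-horizon observability Gramian of the pair `(N, C)`, the integral of
`exp (t Nᵀ) Cᵀ C exp (t N)` over `0 ≤ t ≤ T`. -/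
noncomputable def observabilityGramian (N : Matrix ι ι ℝ) (C : Matrix κ ι ℝ) (T : ℝ) :
    Matrix ι ι ℝ :=
  ∫ t in (0 : ℝ)..T, NormedSpace.exp (t • Nᵀ) * (Cᵀ * C) * NormedSpace.exp (t • N)

variable (N : Matrix ι ι ℝ) (C : Matrix κ ι ℝ) {T : ℝ}

theorem hasDerivAt_exp_mul_exp (Q : Matrix ι ι ℝ) (t : ℝ) :
    HasDerivAt (fun t : ℝ => NormedSpace.exp (t • Nᵀ) * Q * NormedSpace.exp (t • N))
      (Nᵀ * (NormedSpace.exp (t • Nᵀ) * Q * NormedSpace.exp (t • N)) +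
        NormedSpace.exp (t • Nᵀ) * Q * NormedSpace.exp (t • N) * N) t := by
  refine (((hasDerivAt_exp_smul_const' Nᵀ t).mul_const Q).mul
    (hasDerivAt_exp_smul_const N t)).congr_deriv ?_
  noncomm_ring

theorem map_observabilityGramian {E : Type*} [NormedAddCommGroup E] [NormedSpace ℝ E]
    [CompleteSpace E] (φ : Matrix ι ι ℝ →ₗ[ℝ] E) :
    φ (observabilityGramian N C T) =
      ∫ t in (0 : ℝ)..T, φ (NormedSpace.exp (t • Nᵀ) * (Cᵀ * C) * NormedSpace.exp (t • N)) := by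
  have hcont : Continuous fun t : ℝ =>
      NormedSpace.exp (t • Nᵀ) * (Cᵀ * C) * NormedSpace.exp (t • N) :=
    continuous_iff_continuousAt.2 fun t => (hasDerivAt_exp_mul_exp N _ t).continuousAt
  exact ((LinearMap.toContinuousLinearMap φ).intervalIntegral_comp_comm
    (hcont.intervalIntegrable 0 T)).symm

theorem observabilityGramian_lyapunov :
    Nᵀ * observabilityGramian N C T + observabilityGramian N C T * N =
      NormedSpace.exp (T • Nᵀ) * (Cᵀ * C) * NormedSpace.exp (T • N) - Cᵀ * C := by
  let lyap : Matrix ι ι ℝ →ₗ[ℝ] Matrix ι ι ℝ := LinearMap.mulLeft ℝ Nᵀ + LinearMap.mulRight ℝ N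
  have hderiv (t : ℝ) := hasDerivAt_exp_mul_exp N (Cᵀ * C) t
  have hcont : Continuous fun t : ℝ =>
      lyap (NormedSpace.exp (t • Nᵀ) * (Cᵀ * C) * NormedSpace.exp (t • N)) :=
    (LinearMap.continuous_of_finiteDimensional lyap).comp
      (continuous_iff_continuousAt.2 fun t => (hderiv t).continuousAt)
  calc Nᵀ * observabilityGramian N C T + observabilityGramian N C T * N
    _ = ∫ t in (0 : ℝ)..T, lyap (NormedSpace.exp (t • Nᵀ) * (Cᵀ * C) * NormedSpace.exp (t • N)) :=
      map_observabilityGramian N C lyap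
    _ = NormedSpace.exp (T • Nᵀ) * (Cᵀ * C) * NormedSpace.exp (T • N) -
        NormedSpace.exp ((0 : ℝ) • Nᵀ) * (Cᵀ * C) * NormedSpace.exp ((0 : ℝ) • N) :=
      intervalIntegral.integral_eq_sub_of_hasDerivAt (fun t _ => hderiv t)
        (hcont.intervalIntegrable 0 T)
    _ = _ := by simp only [zero_smul, NormedSpace.exp_zero, Matrix.one_mul, Matrix.mul_one]

theorem dotProduct_observabilityGramian_mulVec (v : ι → ℝ) :
    v ⬝ᵥ (observabilityGramian N C T *ᵥ v) = ∫ t in (0 : ℝ)..T,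
      ((C * NormedSpace.exp (t • N)) *ᵥ v) ⬝ᵥ ((C * NormedSpace.exp (t • N)) *ᵥ v) := by
  let quadForm : Matrix ι ι ℝ →ₗ[ℝ] ℝ := dotProductBilin ℝ ℝ v ∘ₗ (mulVecBilin ℝ ℝ).flip v
  refine (map_observabilityGramian N C quadForm).trans
    (intervalIntegral.integral_congr fun t _ => ?_)
  calc v ⬝ᵥ ((NormedSpace.exp (t • Nᵀ) * (Cᵀ * C) * NormedSpace.exp (t • N)) *ᵥ v)
    _ = v ⬝ᵥ (((C * NormedSpace.exp (t • N))ᵀ * (C * NormedSpace.exp (t • N))) *ᵥ v) := by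
      rw [← transpose_smul, exp_transpose, transpose_mul]
      simp only [Matrix.mul_assoc]
    _ = _ := by rw [← mulVec_mulVec, dotProduct_mulVec, vecMul_transpose]

theorem isHermitian_observabilityGramian : (observabilityGramian N C T).IsHermitian := by
  rw [IsHermitian, conjTranspose_eq_transpose_of_trivial]
  refine (map_observabilityGramian N C (transposeLinearEquiv ι ι ℝ ℝ).toLinearMap).trans
    (intervalIntegral.integral_congr fun t _ => ?_)
  change (NormedSpace.exp (t • Nᵀ) * (Cᵀ * C) * NormedSpace.exp (t • N))ᵀ = _
  simp only [transpose_mul, ← exp_transpose, transpose_smul, transpose_transpose, Matrix.mul_assoc]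

theorem mem_unobservableSubspace_of_exp (hT : 0 < T) {v : ι → ℝ}
    (h : ∀ t ∈ Set.Icc 0 T, (C * NormedSpace.exp (t • N)) *ᵥ v = 0) :
    v ∈ unobservableSubspace N C := by
  let U : Set (ι → ℝ) := {v | ∀ t ∈ Set.Icc 0 T, (C * NormedSpace.exp (t • N)) *ᵥ v = 0}
  have hU : ∀ v ∈ U, N *ᵥ v ∈ U := by
    intro v hv t ht
    have hderiv : HasDerivAt (fun t : ℝ => (C * NormedSpace.exp (t • N)) *ᵥ v)
        ((C * NormedSpace.exp (t • N)) *ᵥ (N *ᵥ v)) t := by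
      have hcomm : N * NormedSpace.exp (t • N) = NormedSpace.exp (t • N) * N :=
        mul_exp_eq_exp_mul (by rw [Matrix.mul_smul, Matrix.smul_mul])
      have hd := (LinearMap.toContinuousLinearMap C.mulVecLin).hasFDerivAt.comp_hasDerivAt t
        (hasDerivAt_exp_smul_mulVec N v t)
      simp only [← mulVec_mulVec]
      rw [mulVec_mulVec v, hcomm, ← mulVec_mulVec] at hd
      exact hd
    exact (uniqueDiffOn_Icc hT t ht).eq_deriv _ hderiv.hasDerivWithinAt
      ((hasDerivWithinAt_const t _ 0).congr hv (hv t ht))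
  have hpow (k : ℕ) : N ^ k *ᵥ v ∈ U := by
    induction k with
    | zero => rwa [pow_zero, one_mulVec]
    | succ k ih => rw [pow_succ', ← mulVec_mulVec]; exact hU _ ih
  refine mem_unobservableSubspace.2 fun k => ?_
  simpa using hpow k 0 ⟨le_rfl, hT.le⟩

theorem posDef_observabilityGramian (hT : 0 < T) (h : unobservableSubspace N C = ⊥) :
    (observabilityGramian N C T).PosDef := by
  refine PosDef.of_dotProduct_mulVec_pos (isHermitian_observabilityGramian N C) fun v hv => ?_
  obtain ⟨t, ht, hne⟩ : ∃ t ∈ Set.Icc 0 T, (C * NormedSpace.exp (t • N)) *ᵥ v ≠ 0 := by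
    by_contra! hzero
    exact hv ((Submodule.mem_bot ℝ).1 (h ▸ mem_unobservableSubspace_of_exp N C hT hzero))
  have hcont : Continuous fun t : ℝ => (C * NormedSpace.exp (t • N)) *ᵥ v := by
    have hexp : Continuous fun t : ℝ => NormedSpace.exp (t • N) *ᵥ v :=
      continuous_iff_continuousAt.2 fun t => (hasDerivAt_exp_smul_mulVec N v t).continuousAt
    simp only [← mulVec_mulVec]
    exact continuous_const.matrix_mulVec hexp
  rw [star_trivial, dotProduct_observabilityGramian_mulVec]
  refine intervalIntegral.integral_pos hT (hcont.dotProduct hcont).continuousOn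
    (fun s _ => dotProduct_self_nonneg _) ⟨t, ht, ?_⟩
  exact (dotProduct_self_nonneg _).lt_of_ne fun hzero => hne (dotProduct_self_eq_zero.1 hzero.symm)

end Exponential

section Lyapunov

variable {ι : Type*} [Fintype ι]

theorem dotProduct_mulVec_le_sum_abs_mul (M : Matrix ι ι ℝ) (v : ι → ℝ) :
    v ⬝ᵥ (M *ᵥ v) ≤ (∑ i, ∑ j, |M i j|) * (v ⬝ᵥ v) := by
  have hsq (i : ι) : v i * v i ≤ v ⬝ᵥ v :=
    Finset.single_le_sum (f := fun k => v k * v k) (fun k _ => mul_self_nonneg (v k))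
      (Finset.mem_univ i)
  have hexpand : v ⬝ᵥ (M *ᵥ v) = ∑ i, ∑ j, v i * (M i j * v j) := by
    simp only [dotProduct, mulVec, Finset.mul_sum]
  simp only [hexpand, Finset.sum_mul]
  refine Finset.sum_le_sum fun i _ => Finset.sum_le_sum fun j _ => ?_
  have hij : |v i * v j| ≤ v ⬝ᵥ v := by
    rw [abs_le]
    constructor <;> nlinarith [hsq i, hsq j, sq_nonneg (v i + v j), sq_nonneg (v i - v j)]
  calc v i * (M i j * v j) = M i j * (v i * v j) := by ring
    _ ≤ |M i j| * |v i * v j| := by rw [← abs_mul]; exact le_abs_self _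
    _ ≤ |M i j| * (v ⬝ᵥ v) := by gcongr

open scoped MatrixOrder in
theorem exists_mul_dotProduct_self_le {Q : Matrix ι ι ℝ} (hQ : Q.PosDef) :
    ∃ c > 0, ∀ v, c * (v ⬝ᵥ v) ≤ v ⬝ᵥ (Q *ᵥ v) := by
  classical
  obtain ⟨D, hD⟩ := CStarAlgebra.nonneg_iff_eq_star_mul_self.mp hQ.posSemidef.nonneg
  rw [star_eq_conjTranspose, conjTranspose_eq_transpose_of_trivial] at hD
  have hdet := (isUnit_iff_isUnit_det Q).1 hQ.isUnit
  rw [hD, det_mul] at hdet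
  have hinv : D⁻¹ * D = 1 := nonsing_inv_mul D (isUnit_of_mul_isUnit_right hdet)
  have hquad (P : Matrix ι ι ℝ) (v : ι → ℝ) : v ⬝ᵥ ((Pᵀ * P) *ᵥ v) = (P *ᵥ v) ⬝ᵥ (P *ᵥ v) := by
    rw [← mulVec_mulVec, dotProduct_mulVec, vecMul_transpose]
  set b : ℝ := 1 + ∑ i, ∑ j, |(D⁻¹ᵀ * D⁻¹) i j|
  have hb : 0 < b := by positivity
  refine ⟨b⁻¹, inv_pos.2 hb, fun v => (inv_mul_le_iff₀ hb).2 ?_⟩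
  calc v ⬝ᵥ v = (D *ᵥ v) ⬝ᵥ ((D⁻¹ᵀ * D⁻¹) *ᵥ (D *ᵥ v)) := by
        rw [hquad, mulVec_mulVec, hinv, one_mulVec]
    _ ≤ (∑ i, ∑ j, |(D⁻¹ᵀ * D⁻¹) i j|) * ((D *ᵥ v) ⬝ᵥ (D *ᵥ v)) :=
      dotProduct_mulVec_le_sum_abs_mul _ _
    _ ≤ b * (v ⬝ᵥ (Q *ᵥ v)) := by
      rw [hD, hquad]
      exact mul_le_mul_of_nonneg_right (by linarith) (dotProduct_self_nonneg _)

theorem tendsto_zero_of_dotProduct_self {ζ : ℝ → ι → ℝ}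
    (h : Tendsto (fun t => ζ t ⬝ᵥ ζ t) atTop (𝓝 0)) : Tendsto ζ atTop (𝓝 0) := by
  refine tendsto_pi_nhds.2 fun i => ?_
  have hle (t : ℝ) : |ζ t i| ≤ √(ζ t ⬝ᵥ ζ t) := by
    rw [← Real.sqrt_mul_self_eq_abs]
    exact Real.sqrt_le_sqrt (Finset.single_le_sum (f := fun k => ζ t k * ζ t k)
      (fun k _ => mul_self_nonneg (ζ t k)) (Finset.mem_univ i))
  exact squeeze_zero_norm hle (Real.sqrt_zero ▸ h.sqrt)

theorem tendsto_zero_of_deriv_le {V V' g : ℝ → ℝ} {α : ℝ} (hα : 0 < α) (hV₀ : ∀ t, 0 ≤ V t)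
    (hV : ∀ t, 0 ≤ t → HasDerivWithinAt V (V' t) (Set.Ici 0) t)
    (hle : ∀ t, 0 ≤ t → V' t ≤ -α * V t + g t) (hg : Tendsto g atTop (𝓝 0)) :
    Tendsto V atTop (𝓝 0) := by
  refine tendsto_order.2 ⟨fun a ha => .of_forall fun t => ha.trans_le (hV₀ t), fun ε hε => ?_⟩
  obtain ⟨t₀, ht₀, hgt₀⟩ : ∃ t₀ ≥ 0, ∀ t ≥ t₀, g t ≤ α * (ε / 2) := by
    have hev := (hg.eventually (ge_mem_nhds (show 0 < α * (ε / 2) by positivity))).and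
      (eventually_ge_atTop 0)
    obtain ⟨t₀, ht₀⟩ := eventually_atTop.1 hev
    exact ⟨t₀, (ht₀ t₀ le_rfl).2, fun t ht => (ht₀ t ht).1⟩
  -- from `t₀` on, `V - ε / 2` is dominated by a decaying exponential
  have hsub : Set.Ici t₀ ⊆ Set.Ici 0 := Set.Ici_subset_Ici.2 ht₀
  have hderiv (t : ℝ) (ht : t ∈ Set.Ici t₀) :
      HasDerivWithinAt (fun t => Real.exp (α * t) * (V t - ε / 2))
        (Real.exp (α * t) * (α * (V t - ε / 2) + V' t)) (Set.Ici t₀) t := by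
    have hexp : HasDerivAt (fun t : ℝ => Real.exp (α * t)) (Real.exp (α * t) * α) t := by
      simpa using ((hasDerivAt_id t).const_mul α).exp
    exact (hexp.hasDerivWithinAt.mul (((hV t (hsub ht)).mono hsub).sub_const _)).congr_deriv
      (by ring)
  have hanti : AntitoneOn (fun t => Real.exp (α * t) * (V t - ε / 2)) (Set.Ici t₀) := by
    refine antitoneOn_of_hasDerivWithinAt_nonpos (convex_Ici t₀)
      (fun t ht => (hderiv t ht).continuousWithinAt)
      (fun t ht => (hderiv t (interior_subset ht)).mono interior_subset) fun t ht => ?_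
    have ht' : t₀ ≤ t := interior_subset (s := Set.Ici t₀) ht
    refine mul_nonpos_of_nonneg_of_nonpos (Real.exp_pos _).le ?_
    linarith [hle t (ht₀.trans ht'), hgt₀ t ht']
  have hdecay : Tendsto (fun t => Real.exp (-(α * t)) * (Real.exp (α * t₀) * (V t₀ - ε / 2)))
      atTop (𝓝 0) := by
    simpa using (Real.tendsto_exp_neg_atTop_nhds_zero.comp
      (tendsto_id.const_mul_atTop hα)).mul_const (Real.exp (α * t₀) * (V t₀ - ε / 2))
  filter_upwards [hdecay.eventually (gt_mem_nhds (half_pos hε)), eventually_ge_atTop t₀]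
    with t hsmall ht
  have hVt : V t - ε / 2 ≤ Real.exp (-(α * t)) * (Real.exp (α * t₀) * (V t₀ - ε / 2)) := by
    rw [Real.exp_neg, le_inv_mul_iff₀ (Real.exp_pos _)]
    exact hanti Set.self_mem_Ici ht ht
  linarith

theorem hasDerivWithinAt_dotProduct {x y : ℝ → ι → ℝ} {x' y' : ι → ℝ} {s : Set ℝ} {t : ℝ}
    (hx : HasDerivWithinAt x x' s t) (hy : HasDerivWithinAt y y' s t) :
    HasDerivWithinAt (fun t => x t ⬝ᵥ y t) (x' ⬝ᵥ y t + x t ⬝ᵥ y') s t := by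
  have hsum := HasDerivWithinAt.fun_sum fun i (_ : i ∈ Finset.univ) =>
    (hasDerivWithinAt_pi.1 hx i).mul (hasDerivWithinAt_pi.1 hy i)
  rwa [Finset.sum_add_distrib] at hsum

theorem hasDerivWithinAt_const_mulVec {κ : Type*} [Finite κ] (M : Matrix κ ι ℝ) {x : ℝ → ι → ℝ}
    {x' : ι → ℝ} {s : Set ℝ} {t : ℝ} (hx : HasDerivWithinAt x x' s t) :
    HasDerivWithinAt (fun t => M *ᵥ x t) (M *ᵥ x') s t :=
  have := Fintype.ofFinite κ
  (LinearMap.toContinuousLinearMap M.mulVecLin).hasFDerivAt.comp_hasDerivWithinAt t hx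

theorem tendsto_const_mulVec {κ : Type*} (M : Matrix κ ι ℝ) {x : ℝ → ι → ℝ}
    (hx : Tendsto x atTop (𝓝 0)) : Tendsto (fun t => M *ᵥ x t) atTop (𝓝 0) := by
  have hcont : Continuous fun v : ι → ℝ => M *ᵥ v := continuous_const.matrix_mulVec continuous_id
  exact mulVec_zero M ▸ (hcont.tendsto 0).comp hx

/-- `W` certifies the asymptotic stability of `x' = N x`: the quadratic form of `W` is a strict
Lyapunov function for it. -/
structure IsLyapunovMatrix (N W : Matrix ι ι ℝ) : Prop where
  posDef : W.PosDef
  posDef_decay : (-(Nᵀ * W + W * N)).PosDef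

variable {N W : Matrix ι ι ℝ}

/-- The cross term `2 (z ⬝ W b)` is absorbed by the decay `c (z ⬝ z)` of the form. -/
theorem IsLyapunovMatrix.exists_deriv_le (hW : IsLyapunovMatrix N W) :
    ∃ α > 0, ∃ γ : ℝ, ∀ z b : ι → ℝ,
      (N *ᵥ z + b) ⬝ᵥ (W *ᵥ z) + z ⬝ᵥ (W *ᵥ (N *ᵥ z + b)) ≤
        -α * (z ⬝ᵥ (W *ᵥ z)) + γ * ((W *ᵥ b) ⬝ᵥ (W *ᵥ b)) := by
  obtain ⟨c, hc, hQ⟩ := exists_mul_dotProduct_self_le hW.posDef_decay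
  set β : ℝ := 1 + ∑ i, ∑ j, |W i j|
  have hβ : 0 < β := by positivity
  have hWle (z : ι → ℝ) : z ⬝ᵥ (W *ᵥ z) ≤ β * (z ⬝ᵥ z) :=
    (dotProduct_mulVec_le_sum_abs_mul W z).trans
      (mul_le_mul_of_nonneg_right (by linarith) (dotProduct_self_nonneg z))
  refine ⟨c / 2 / β, by positivity, 2 / c, fun z b => ?_⟩
  have hsymm (x y : ι → ℝ) : x ⬝ᵥ (W *ᵥ y) = y ⬝ᵥ (W *ᵥ x) := by
    have hWT : Wᵀ = W := (conjTranspose_eq_transpose_of_trivial W).symm.trans hW.posDef.isHermitian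
    rw [dotProduct_mulVec, ← mulVec_transpose, hWT, dotProduct_comm]
  have hexpand : (N *ᵥ z + b) ⬝ᵥ (W *ᵥ z) + z ⬝ᵥ (W *ᵥ (N *ᵥ z + b)) =
      2 * (z ⬝ᵥ (W *ᵥ b)) - z ⬝ᵥ (-(Nᵀ * W + W * N) *ᵥ z) := by
    have hNT : z ⬝ᵥ ((Nᵀ * W) *ᵥ z) = (N *ᵥ z) ⬝ᵥ (W *ᵥ z) := by
      rw [← mulVec_mulVec, dotProduct_mulVec, vecMul_transpose]
    rw [neg_mulVec, add_mulVec, dotProduct_neg, dotProduct_add, hNT, ← mulVec_mulVec,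
      add_dotProduct, mulVec_add, dotProduct_add, hsymm b z]
    ring
  have hyoung : 2 * (z ⬝ᵥ (W *ᵥ b)) ≤ c / 2 * (z ⬝ᵥ z) + 2 / c * ((W *ᵥ b) ⬝ᵥ (W *ᵥ b)) := by
    have hsq := dotProduct_self_nonneg ((c / 2) • z - W *ᵥ b)
    simp only [sub_dotProduct, dotProduct_sub, smul_dotProduct, dotProduct_smul, smul_eq_mul,
      dotProduct_comm (W *ᵥ b) z] at hsq
    have hscaled := mul_nonneg (show 0 ≤ 2 / c by positivity) hsq
    field_simp at hscaled ⊢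
    linarith
  have hVle : c / 2 / β * (z ⬝ᵥ (W *ᵥ z)) ≤ c / 2 * (z ⬝ᵥ z) := by
    rw [div_mul_eq_mul_div, div_le_iff₀ hβ]
    nlinarith [hWle z]
  linarith [hQ z]

theorem IsLyapunovMatrix.tendsto_zero (hW : IsLyapunovMatrix N W) {ζ b : ℝ → ι → ℝ}
    (hζ : ∀ t, 0 ≤ t → HasDerivWithinAt ζ (N *ᵥ ζ t + b t) (Set.Ici 0) t)
    (hb : Tendsto b atTop (𝓝 0)) : Tendsto ζ atTop (𝓝 0) := by
  obtain ⟨α, hα, γ, hderiv⟩ := hW.exists_deriv_le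
  obtain ⟨c, hc, hlower⟩ := exists_mul_dotProduct_self_le hW.posDef
  have hforcing : Tendsto (fun t => γ * ((W *ᵥ b t) ⬝ᵥ (W *ᵥ b t))) atTop (𝓝 0) := by
    have hWb := tendsto_const_mulVec W hb
    have hcont : Continuous fun v : ι → ℝ => γ * (v ⬝ᵥ v) :=
      continuous_const.mul (continuous_id.dotProduct continuous_id)
    simpa [Function.comp_def] using (hcont.tendsto 0).comp hWb
  have hV : Tendsto (fun t => ζ t ⬝ᵥ (W *ᵥ ζ t)) atTop (𝓝 0) :=
    tendsto_zero_of_deriv_le hα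
      (fun t => (mul_nonneg hc.le (dotProduct_self_nonneg _)).trans (hlower _))
      (fun t ht => hasDerivWithinAt_dotProduct (hζ t ht)
        (hasDerivWithinAt_const_mulVec W (hζ t ht)))
      (fun t _ => hderiv (ζ t) (b t)) hforcing
  refine tendsto_zero_of_dotProduct_self (squeeze_zero (fun t => dotProduct_self_nonneg _)
    (fun t => (le_inv_mul_iff₀ hc).2 (hlower (ζ t))) ?_)
  simpa using hV.const_mul c⁻¹

end Lyapunov

section Stabilization

variable {ι κ : Type*} [Fintype ι] [DecidableEq ι] [Fintype κ]

/-- The Gramian of the shifted pair `(-(A + 1), C)` is a Lyapunov matrix for `A - L C`: the shift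
by `1` contributes the strict decay. -/
theorem exists_isLyapunovMatrix_sub_mul_output {A : Matrix ι ι ℝ} {C : Matrix κ ι ℝ}
    (h : unobservableSubspace A C = ⊥) :
    ∃ (L : Matrix ι κ ℝ) (W : Matrix ι ι ℝ), IsLyapunovMatrix (A - L * C) W := by
  set N : Matrix ι ι ℝ := -(A + 1) with hN
  have hNC : unobservableSubspace N C = ⊥ := by
    refine le_bot_iff.1 (h ▸ le_unobservableSubspace
      (fun v => mulVec_eq_zero_of_mem_unobservableSubspace) fun v hv => ?_)
    have hAv : A *ᵥ v = -(N *ᵥ v) - v := by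
      rw [hN, neg_mulVec, add_mulVec, one_mulVec]
      abel
    rw [hAv]
    exact sub_mem (neg_mem (mulVec_mem_unobservableSubspace hv)) hv
  set W := observabilityGramian N C 1
  have hW : W.PosDef := posDef_observabilityGramian N C one_pos hNC
  have hWT : Wᵀ = W := (conjTranspose_eq_transpose_of_trivial W).symm.trans hW.isHermitian
  set L : Matrix ι κ ℝ := (1 / 2 : ℝ) • (W⁻¹ * Cᵀ)
  have hWL : W * L = (1 / 2 : ℝ) • Cᵀ := by
    rw [Matrix.mul_smul, mul_nonsing_inv_cancel_left _ _ ((isUnit_iff_isUnit_det W).1 hW.isUnit)]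
  set E : Matrix κ ι ℝ := C * NormedSpace.exp ((1 : ℝ) • N)
  have hlyap : Nᵀ * W + W * N = Eᵀ * E - Cᵀ * C := by
    rw [observabilityGramian_lyapunov, transpose_mul, ← exp_transpose, transpose_smul]
    simp only [E, Matrix.mul_assoc]
  have hLW : (L * C)ᵀ * W = (1 / 2 : ℝ) • (Cᵀ * C) := by
    rw [← hWT, ← transpose_mul, ← Matrix.mul_assoc, hWL, transpose_mul, transpose_smul,
      transpose_transpose, Matrix.mul_smul]
  have hdecay : -((A - L * C)ᵀ * W + W * (A - L * C)) = (2 : ℝ) • W + Eᵀ * E := by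
    rw [transpose_sub, Matrix.sub_mul, hLW, Matrix.mul_sub, ← Matrix.mul_assoc, hWL,
      Matrix.smul_mul, sub_eq_iff_eq_add.1 hlyap.symm, hN]
    simp only [transpose_neg, transpose_add, transpose_one, Matrix.neg_mul, Matrix.mul_neg,
      Matrix.add_mul, Matrix.mul_add, Matrix.one_mul, Matrix.mul_one]
    module
  refine ⟨L, W, hW, hdecay ▸ (hW.smul two_pos).add_posSemidef ?_⟩
  exact conjTranspose_eq_transpose_of_trivial E ▸ posSemidef_conjTranspose_mul_self E

theorem IsLyapunovMatrix.inv_of_transpose {N W : Matrix ι ι ℝ} (hW : IsLyapunovMatrix Nᵀ W) :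
    IsLyapunovMatrix N W⁻¹ := by
  refine ⟨hW.posDef.inv, ?_⟩
  have hunit : IsUnit W.det := (isUnit_iff_isUnit_det W).1 hW.posDef.isUnit
  have hdecay : -(Nᵀ * W⁻¹ + W⁻¹ * N) = W⁻¹ * -(Nᵀᵀ * W + W * Nᵀ) * star W⁻¹ := by
    rw [star_eq_conjTranspose, hW.posDef.inv.isHermitian.eq, transpose_transpose]
    simp only [Matrix.mul_neg, Matrix.neg_mul, Matrix.mul_add, Matrix.add_mul, Matrix.mul_assoc,
      mul_nonsing_inv W hunit, Matrix.mul_one, nonsing_inv_mul_cancel_left _ _ hunit]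
    rw [add_comm]
  rw [hdecay]
  exact (Matrix.IsUnit.posDef_star_right_conjugate_iff
    (isUnit_nonsing_inv_iff.2 hW.posDef.isUnit)).2 hW.posDef_decay

theorem exists_isLyapunovMatrix_sub_input_mul {A : Matrix ι ι ℝ} {B : Matrix ι κ ℝ}
    (h : unobservableSubspace Aᵀ Bᵀ = ⊥) :
    ∃ (K : Matrix κ ι ℝ) (W : Matrix ι ι ℝ), IsLyapunovMatrix (A - B * K) W := by
  obtain ⟨L, W, hW⟩ := exists_isLyapunovMatrix_sub_mul_output h
  refine ⟨Lᵀ, W⁻¹, IsLyapunovMatrix.inv_of_transpose ?_⟩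
  rwa [transpose_sub, transpose_mul, transpose_transpose]

/-- Once `exp (T N)` is small, the Gramian `W` of `(N, 1)` over `[0, T]` is a Lyapunov matrix,
because `Nᵀ W + W N = exp (T Nᵀ) exp (T N) - 1`. -/
theorem exists_isLyapunovMatrix_of_tendsto_exp {N : Matrix ι ι ℝ}
    (h : ∀ v, Tendsto (fun t : ℝ => NormedSpace.exp (t • N) *ᵥ v) atTop (𝓝 0)) :
    ∃ W, IsLyapunovMatrix N W := by
  set E : ℝ → Matrix ι ι ℝ := fun t => NormedSpace.exp (t • N)
  have hentry (i j : ι) : Tendsto (fun t => E t i j) atTop (𝓝 0) := by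
    simpa using (tendsto_pi_nhds.1 (h (Pi.single j 1))) i
  have hsum : Tendsto (fun t => ∑ i, ∑ j, |((E t)ᵀ * E t) i j|) atTop (𝓝 0) := by
    have hprod (i j : ι) : Tendsto (fun t => |((E t)ᵀ * E t) i j|) atTop (𝓝 0) := by
      simpa [Matrix.mul_apply] using
        (tendsto_finsetSum Finset.univ fun k _ => (hentry k i).mul (hentry k j)).abs
    simpa using tendsto_finsetSum Finset.univ fun i _ =>
      tendsto_finsetSum Finset.univ fun j _ => hprod i j
  obtain ⟨T, hsmall, hT⟩ :=
    ((hsum.eventually (gt_mem_nhds one_pos)).and (eventually_gt_atTop 0)).exists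
  have hobs : unobservableSubspace N (1 : Matrix ι ι ℝ) = ⊥ := by
    refine (Submodule.eq_bot_iff _).2 fun v hv => ?_
    simpa only [one_mulVec] using mulVec_eq_zero_of_mem_unobservableSubspace hv
  refine ⟨_, posDef_observabilityGramian N 1 hT hobs, ?_⟩
  have hdecay : -(Nᵀ * observabilityGramian N (1 : Matrix ι ι ℝ) T +
      observabilityGramian N (1 : Matrix ι ι ℝ) T * N) = 1 - (E T)ᵀ * E T := by
    rw [observabilityGramian_lyapunov, ← transpose_smul, exp_transpose, transpose_one,
      Matrix.mul_one, Matrix.mul_one, neg_sub]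
  rw [hdecay]
  refine PosDef.of_dotProduct_mulVec_pos ?_ fun v hv => ?_
  · exact isHermitian_one.sub
      (conjTranspose_eq_transpose_of_trivial (E T) ▸ isHermitian_conjTranspose_mul_self (E T))
  · have hpos : 0 < v ⬝ᵥ v :=
      (dotProduct_self_nonneg v).lt_of_ne fun h0 => hv (dotProduct_self_eq_zero.1 h0.symm)
    rw [star_trivial, sub_mulVec, one_mulVec, dotProduct_sub, sub_pos]
    exact (dotProduct_mulVec_le_sum_abs_mul _ v).trans_lt (mul_lt_of_lt_one_left hpos hsmall)

end Stabilization

section Controller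

theorem linearIndependent_row_map_ofReal {ι l : Type*} [Finite ι] {M : Matrix ι l ℝ}
    (hM : LinearIndependent ℝ M.row) : LinearIndependent ℂ (M.map Complex.ofReal).row := by
  have := Fintype.ofFinite ι
  rw [linearIndependent_row_iff_vecMul] at hM ⊢
  intro v hv
  rw [← mulVec_transpose, ← transpose_map, map_ofReal_mulVec_eq_zero_iff] at hv
  simp only [mulVec_transpose] at hv
  exact funext fun i => Complex.ext (congrFun (hM _ hv.1) i) (congrFun (hM _ hv.2) i)

theorem surjective_mulVec_of_linearIndependent_row {K ι l : Type*} [Field K] [Finite ι] [Fintype l]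
    {M : Matrix ι l K} (hM : LinearIndependent K M.row) : Function.Surjective M.mulVec := by
  have := Fintype.ofFinite ι
  refine (LinearMap.range_eq_top (f := M.mulVecLin)).1 (Submodule.eq_top_of_finrank_eq ?_)
  rw [Module.finrank_fintype_fun_eq_card]
  exact hM.rank_matrix

variable {n m p q r : ℕ} {ι κ : Type} [Fintype ι] [Fintype κ]
variable {A : Matrix (Fin n) (Fin n) ℝ} {B : Matrix (Fin n) (Fin m) ℝ}
  {C : Matrix (Fin p) (Fin n) ℝ} {F : Matrix (Fin r) (Fin n) ℝ} {Fb : Matrix ι (Fin n) ℝ}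

theorem controllerRankConditions_iff [DecidableEq ι] (hFb : LinearIndependent ℝ Fb.row)
    {M : Matrix ι ι ℝ} (hM : Fb * A = M * Fb) :
    ControllerRankConditions A B Fb ↔ unobservableSubspace Mᵀ (Fb * B)ᵀ = ⊥ := by
  have hrank : (fromRows (Fb * A) Fb).rank = Fb.rank := rank_fromRows_eq_right_iff.2 ⟨M, hM⟩
  have hpencil (s : ℂ) (v : ι → ℂ) :
      v ᵥ* fromCols (s • Fb.map Complex.ofReal - (Fb * A).map Complex.ofReal)
          ((Fb * B).map Complex.ofReal) = 0 ↔
        (Mᵀ.map Complex.ofReal) *ᵥ v = s • v ∧ ((Fb * B)ᵀ.map Complex.ofReal) *ᵥ v = 0 := by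
    have hfactor : v ᵥ* (s • Fb.map Complex.ofReal - (Fb * A).map Complex.ofReal) =
        (s • v - v ᵥ* M.map Complex.ofReal) ᵥ* Fb.map Complex.ofReal := by
      rw [hM, map_ofReal_mul, vecMul_sub, sub_vecMul, vecMul_smul, smul_vecMul, vecMul_vecMul]
    have hinj := vecMul_injective_iff.2 (linearIndependent_row_map_ofReal hFb)
    rw [vecMul_fromCols, ← Sum.elim_zero_zero, Sum.elim_eq_iff, hfactor,
      ← zero_vecMul (Fb.map Complex.ofReal), hinj.eq_iff, transpose_map, transpose_map,
      mulVec_transpose, mulVec_transpose, sub_eq_zero, eq_comm]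
  rw [ControllerRankConditions, and_iff_right hrank, hFb.rank_matrix,
    ← unobservableSubspace_map_ofReal_eq_bot_iff, unobservableSubspace_eq_bot_iff_hautus]
  simp only [rank_eq_card_iff_linearIndependent_row, linearIndependent_row_iff_vecMul, hpencil,
    and_imp]

theorem ControllerRankConditions.exists_mul_eq (h : ControllerRankConditions A B Fb) :
    ∃ M : Matrix ι ι ℝ, Fb * A = M * Fb :=
  rank_fromRows_eq_right_iff.1 h.1

/-- Controllability is inherited by an invariant functional that factors through a controllable
one: `Lᵀ` embeds the dynamics on the smaller dual space into those on the larger one. -/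
theorem ControllerRankConditions.of_eq_mul {Fh : Matrix κ (Fin n) ℝ}
    (h : ControllerRankConditions A B Fh) (hFh : LinearIndependent ℝ Fh.row)
    (hFb : LinearIndependent ℝ Fb.row) {M : Matrix ι ι ℝ} (hM : Fb * A = M * Fb)
    {L : Matrix ι κ ℝ} (hL : Fb = L * Fh) :
    ControllerRankConditions A B Fb := by
  classical
  obtain ⟨Mh, hMh⟩ := h.exists_mul_eq
  have hLM : Lᵀ * Mᵀ = Mhᵀ * Lᵀ := by
    have hfactor : (M * L) * Fh = (L * Mh) * Fh := by
      rw [Matrix.mul_assoc, ← hL, ← hM, Matrix.mul_assoc, ← hMh, ← Matrix.mul_assoc, ← hL]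
    have hML : M * L = L * Mh := by
      refine Matrix.ext_row fun i => vecMul_injective_iff.2 hFh ?_
      simpa only [row_def, mul_apply_eq_vecMul] using congrFun hfactor i
    rw [← transpose_mul, hML, transpose_mul]
  rw [controllerRankConditions_iff hFh hMh] at h
  rw [controllerRankConditions_iff hFb hM, Submodule.eq_bot_iff]
  intro v hv
  have hLv : Lᵀ *ᵥ v = 0 := by
    rw [hL, Matrix.mul_assoc, transpose_mul, mem_unobservableSubspace_mul_iff hLM, h] at hv
    exact hv
  rw [mulVec_transpose] at hLv
  refine linearIndependent_row_iff_vecMul.1 hFb v ?_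
  rw [hL, ← vecMul_vecMul, hLv, zero_vecMul]

theorem RowsFormBasis.exists_mul_eq (hFb : RowsFormBasis Fb (intrinsicSubspace A F)) :
    ∃ M : Matrix ι ι ℝ, Fb * A = M * Fb := by
  rw [exists_eq_mul_iff_span_row_le, hFb.2, Submodule.span_le]
  rintro _ ⟨i, rfl⟩
  exact vecMul_mem_intrinsicSubspace (hFb.2 ▸ Submodule.subset_span ⟨i, rfl⟩)

theorem RowsFormBasis.controllerRankConditions
    (hFb : RowsFormBasis Fb (intrinsicSubspace A F))
    (hIFC : IsIntrinsicallyFunctionallyControllable A B F) :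
    ControllerRankConditions A B Fb := by
  classical
  obtain ⟨k, R, -, hrank, hctrl⟩ := hIFC
  have hFh : LinearIndependent ℝ (fromRows F R).row := by
    simpa [← rank_eq_card_iff_linearIndependent_row] using hrank
  have hle : intrinsicSubspace A F ≤ Submodule.span ℝ (Set.range (fromRows F R).row) := by
    obtain ⟨M, hM⟩ := hctrl.exists_mul_eq
    refine intrinsicSubspace_le (fun i => Submodule.subset_span ⟨Sum.inl i, rfl⟩) fun v hv => ?_
    suffices hmap : Submodule.span ℝ (Set.range (fromRows F R).row) ≤
        (Submodule.span ℝ (Set.range (fromRows F R).row)).comap A.vecMulLinear from hmap hv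
    rw [Submodule.span_le]
    rintro _ ⟨i, rfl⟩
    exact exists_eq_mul_iff_span_row_le.1 ⟨M, hM⟩ (Submodule.subset_span ⟨i, rfl⟩)
  obtain ⟨L, hL⟩ : ∃ L : Matrix ι (Fin r ⊕ Fin k) ℝ, Fb = L * fromRows F R :=
    exists_eq_mul_iff_span_row_le.2 (hFb.2.trans_le hle)
  obtain ⟨M, hM⟩ := hFb.exists_mul_eq
  exact hctrl.of_eq_mul hFh hFb.1 hM hL

theorem exists_isFunctionalController (hFb : LinearIndependent ℝ Fb.row)
    (h : ControllerRankConditions A B Fb) :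
    ∃ K : Matrix (Fin m) ι ℝ, IsFunctionalController A B Fb K := by
  classical
  obtain ⟨M, hM⟩ := h.exists_mul_eq
  obtain ⟨K, W, hW⟩ :=
    exists_isLyapunovMatrix_sub_input_mul ((controllerRankConditions_iff hFb hM).1 h)
  refine ⟨K, fun x hx => hW.tendsto_zero (b := fun _ => 0) (fun t ht => ?_) tendsto_const_nhds⟩
  refine (hasDerivWithinAt_const_mulVec Fb (hx t ht)).congr_deriv ?_
  rw [mulVec_add, mulVec_mulVec, hM]
  simp only [mulVec_neg, sub_mulVec, mulVec_mulVec, Matrix.sub_mul, Matrix.mul_assoc, add_zero,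
    ← sub_eq_add_neg]

/-- As `Fb` is onto, the quotient dynamics `M - Fb B K` inherit their stability from the
trajectories of the controlled system. -/
theorem IsFunctionalController.exists_isLyapunovMatrix {K : Matrix (Fin m) ι ℝ}
    (hK : IsFunctionalController A B Fb K) (hFb : LinearIndependent ℝ Fb.row) {M : Matrix ι ι ℝ}
    (hM : Fb * A = M * Fb) : ∃ W, IsLyapunovMatrix (M - Fb * B * K) W := by
  classical
  refine exists_isLyapunovMatrix_of_tendsto_exp fun v => ?_
  obtain ⟨x₀, rfl⟩ := surjective_mulVec_of_linearIndependent_row hFb v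
  have hintertwine (t : ℝ) : Fb * (t • (A - B * K * Fb)) = (t • (M - Fb * B * K)) * Fb := by
    simp only [Matrix.mul_smul, Matrix.smul_mul, Matrix.mul_sub, Matrix.sub_mul, hM,
      Matrix.mul_assoc]
  simp only [mulVec_mulVec, ← mul_exp_eq_exp_mul (hintertwine _)]
  simp only [← mulVec_mulVec]
  refine hK _ fun t _ => (hasDerivAt_exp_smul_mulVec _ x₀ t).hasDerivWithinAt.congr_deriv ?_
  simp only [sub_mulVec, mulVec_neg, ← mulVec_mulVec, ← sub_eq_add_neg]

theorem tendsto_zero_of_isClosedLoopSolution {M : Matrix ι ι ℝ} (hM : Fb * A = M * Fb)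
    (hFb : LinearIndependent ℝ Fb.row) {K : Matrix (Fin m) ι ℝ}
    (hK : IsFunctionalController A B Fb K) {O : LinearObserver q p m ι}
    (hO : IsFunctionalObserver A B C Fb O) {x : ℝ → Fin n → ℝ} {w : ℝ → Fin q → ℝ}
    (hxw : IsClosedLoopSolution A B C K O x w) : Tendsto (fun t => Fb *ᵥ x t) atTop (𝓝 0) := by
  classical
  obtain ⟨W, hW⟩ := hK.exists_isLyapunovMatrix hFb hM
  have hinput : ContinuousOn (fun t => -(K *ᵥ O.estimate (w t) (C *ᵥ x t))) (Set.Ici 0) := by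
    have hx : ContinuousOn x (Set.Ici 0) := fun t ht => (hxw.1 t ht).continuousWithinAt
    have hw : ContinuousOn w (Set.Ici 0) := fun t ht => (hxw.2 t ht).continuousWithinAt
    unfold LinearObserver.estimate
    fun_prop
  have herror := tendsto_const_mulVec (-(Fb * B * K)) (hO _ x w hinput hxw.1 hxw.2)
  refine hW.tendsto_zero (fun t ht => ?_) herror
  refine (hasDerivWithinAt_const_mulVec Fb (hxw.1 t ht)).congr_deriv ?_
  rw [mulVec_add, mulVec_mulVec, hM]
  simp only [mulVec_sub, mulVec_neg, neg_mulVec, mulVec_mulVec, Matrix.sub_mul, Matrix.neg_mul,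
    Matrix.mul_assoc, sub_mulVec]
  abel

theorem exists_isClosedLoopSolution (A : Matrix (Fin n) (Fin n) ℝ) (B : Matrix (Fin n) (Fin m) ℝ)
    (C : Matrix (Fin p) (Fin n) ℝ) (K : Matrix (Fin m) ι ℝ) (O : LinearObserver q p m ι)
    (x₀ : Fin n → ℝ) (w₀ : Fin q → ℝ) :
    ∃ (x : ℝ → Fin n → ℝ) (w : ℝ → Fin q → ℝ),
      x 0 = x₀ ∧ w 0 = w₀ ∧ IsClosedLoopSolution A B C K O x w := by
  let Φ : Matrix (Fin n ⊕ Fin q) (Fin n ⊕ Fin q) ℝ :=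
    fromBlocks (A - B * K * O.E * C) (-(B * K * O.D))
      (O.J * C - O.H * K * O.E * C) (O.N - O.H * K * O.D)
  let z : ℝ → Fin n ⊕ Fin q → ℝ := fun t => NormedSpace.exp (t • Φ) *ᵥ Sum.elim x₀ w₀
  have hz0 : z 0 = Sum.elim x₀ w₀ := by
    simp only [z, zero_smul, NormedSpace.exp_zero, one_mulVec]
  have hz (t : ℝ) : HasDerivAt z (Φ *ᵥ z t) t := hasDerivAt_exp_smul_mulVec Φ _ t
  refine ⟨fun t => z t ∘ Sum.inl, fun t => z t ∘ Sum.inr, congrArg (· ∘ Sum.inl) hz0,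
    congrArg (· ∘ Sum.inr) hz0, fun t _ => ?_, fun t _ => ?_⟩
  · have hx : HasDerivAt (fun t => z t ∘ Sum.inl) ((Φ *ᵥ z t) ∘ Sum.inl) t :=
      hasDerivAt_pi.2 fun i => hasDerivAt_pi.1 (hz t) (Sum.inl i)
    refine hx.hasDerivWithinAt.congr_deriv ?_
    simp only [Φ, fromBlocks_mulVec, Sum.elim_comp_inl, LinearObserver.estimate, mulVec_add,
      mulVec_neg, sub_mulVec, neg_mulVec, mulVec_mulVec, Matrix.mul_assoc]
    abel
  · have hw : HasDerivAt (fun t => z t ∘ Sum.inr) ((Φ *ᵥ z t) ∘ Sum.inr) t :=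
      hasDerivAt_pi.2 fun i => hasDerivAt_pi.1 (hz t) (Sum.inr i)
    refine hw.hasDerivWithinAt.congr_deriv ?_
    simp only [Φ, fromBlocks_mulVec, Sum.elim_comp_inr, LinearObserver.estimate, mulVec_add,
      mulVec_neg, sub_mulVec, mulVec_mulVec, Matrix.mul_assoc]
    abel

end Controller

section BasisCompletion

theorem exists_linearIndependent_sumElim_comp {K V ι κ : Type*} [DivisionRing K] [AddCommGroup V]
    [Module K V] [Finite κ] {v : ι → V} (hv : LinearIndependent K v) (w : κ → V) :
    ∃ (k : ℕ) (σ : Fin k → κ), LinearIndependent K (Sum.elim v (w ∘ σ)) ∧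
      Submodule.span K (Set.range (Sum.elim v (w ∘ σ))) =
        Submodule.span K (Set.range (Sum.elim v w)) := by
  obtain ⟨b, -, hinl, hspan, hb⟩ := exists_linearIndepOn_extension (v := Sum.elim v w)
    ((linearIndepOn_range_iff Sum.inl_injective _).2 hv) (Set.subset_univ _)
  let e := Finite.equivFin (Sum.inr ⁻¹' b)
  let f : ι ⊕ Fin _ → ι ⊕ κ := Sum.map id fun i => (e.symm i : κ)
  have hf : Function.Injective f :=
    Function.injective_id.sumMap (Subtype.val_injective.comp e.symm.injective)
  have hrange : Set.range f = b := by
    ext (i | j)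
    · exact iff_of_true ⟨Sum.inl i, rfl⟩ (hinl ⟨i, rfl⟩)
    · refine ⟨?_, fun hj => ⟨Sum.inr (e ⟨j, hj⟩), ?_⟩⟩
      · rintro ⟨i | i, hi⟩
        · exact absurd hi Sum.inl_ne_inr
        · exact Sum.inr_injective hi ▸ (e.symm i).2
      · exact congrArg (Sum.inr ∘ Subtype.val) (e.symm_apply_apply ⟨j, hj⟩)
  have hcomp : Sum.elim v (w ∘ fun i => (e.symm i : κ)) = Sum.elim v w ∘ f := by
    ext (i | i) <;> rfl
  refine ⟨_, fun i => e.symm i, ?_, ?_⟩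
  · rw [hcomp, ← linearIndepOn_range_iff hf, hrange]
    exact hb
  · rw [hcomp]
    refine (Submodule.span_mono (Set.range_comp_subset_range _ _)).antisymm ?_
    rwa [Submodule.span_le, Set.range_comp, hrange, ← Set.image_univ]

variable {n r : ℕ} {ι : Type}

theorem exists_isRowBasisCompletion (A : Matrix (Fin n) (Fin n) ℝ) {F : Matrix (Fin r) (Fin n) ℝ}
    (hF : LinearIndependent ℝ F.row) :
    ∃ (k₁ : ℕ) (R₁ : Matrix (Fin k₁) (Fin n) ℝ), IsRowBasisCompletion A F R₁ := by
  obtain ⟨k₁, σ, hLI, hspan⟩ := exists_linearIndependent_sumElim_comp hF (obsMatrix A F).row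
  have hrow : (fromRows F ((obsMatrix A F).submatrix σ id)).row =
      Sum.elim F.row ((obsMatrix A F).row ∘ σ) := by
    ext (i | i) <;> rfl
  refine ⟨k₁, _, ⟨σ, rfl⟩, hrow ▸ hLI, ?_⟩
  rw [hrow, hspan, Set.Sum.elim_range, Submodule.span_union, sup_eq_right, Submodule.span_le,
    ← intrinsicSubspace_eq_span_row, Set.range_subset_iff]
  intro i
  simpa using row_mul_pow_mem_intrinsicSubspace (A := A) (F := F) 0 i

theorem exists_rowsFormBasis (V : Submodule ℝ (Fin n → ℝ)) :
    ∃ (k : ℕ) (M : Matrix (Fin k) (Fin n) ℝ), RowsFormBasis M V := by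
  let b := Module.finBasis ℝ V
  refine ⟨_, fun i => (b i : Fin n → ℝ), b.linearIndependent.map' V.subtype V.ker_subtype, ?_⟩
  have hrange : Set.range (row fun i => (b i : Fin n → ℝ)) = V.subtype '' Set.range b :=
    Set.range_comp V.subtype b
  rw [hrange, Submodule.span_image, b.span_eq, Submodule.map_subtype_top]

theorem exists_rowsFormBasis_top {M : Matrix ι (Fin n) ℝ} (hM : LinearIndependent ℝ M.row) :
    ∃ (k : ℕ) (P : Matrix (Fin k) (Fin n) ℝ), RowsFormBasis (fromRows M P) ⊤ := by
  obtain ⟨k, σ, hLI, hspan⟩ :=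
    exists_linearIndependent_sumElim_comp hM (Pi.basisFun ℝ (Fin n))
  refine ⟨k, fun i => Pi.basisFun ℝ (Fin n) (σ i), hLI, hspan.trans (top_le_iff.1 ?_)⟩
  rw [← (Pi.basisFun ℝ (Fin n)).span_eq]
  exact Submodule.span_mono (Set.Sum.elim_range _ _ ▸ Set.subset_union_right)

theorem rank_eq_add_of_linearIndependent_row {k : ℕ} {M : Matrix (Fin r ⊕ Fin k) (Fin n) ℝ}
    (hM : LinearIndependent ℝ M.row) : M.rank = r + k := by
  simpa only [Fintype.card_sum, Fintype.card_fin] using hM.rank_matrix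

theorem RowsFormBasis.range_mulVecLin_transpose [Fintype ι] {M : Matrix ι (Fin n) ℝ}
    {V : Submodule ℝ (Fin n → ℝ)} (hM : RowsFormBasis M V) :
    LinearMap.range Mᵀ.mulVecLin = V := by
  rw [range_mulVecLin]
  exact hM.2

theorem RowsFormBasis.finrank_eq [Fintype ι] {M : Matrix ι (Fin n) ℝ}
    {V : Submodule ℝ (Fin n → ℝ)} (hM : RowsFormBasis M V) :
    Module.finrank ℝ V = Fintype.card ι := by
  rw [← hM.2, ← rank_eq_finrank_span_row, hM.1.rank_matrix]

theorem RowsFormBasis.exists_mul_eq_one [Fintype ι] {M : Matrix ι (Fin n) ℝ}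
    (hM : RowsFormBasis M ⊤) : ∃ L : Matrix (Fin n) ι ℝ, L * M = 1 := by
  obtain ⟨L, hL⟩ : ∃ L : Matrix (Fin n) ι ℝ, 1 = L * M :=
    exists_eq_mul_iff_span_row_le.2 (hM.2 ▸ le_top)
  exact ⟨L, hL.symm⟩

theorem RowsFormBasis.eq_zero_of_mulVec_eq_zero [Finite ι] {M : Matrix ι (Fin n) ℝ}
    (hM : RowsFormBasis M ⊤) {v : Fin n → ℝ} (hv : M *ᵥ v = 0) : v = 0 := by
  have := Fintype.ofFinite ι
  obtain ⟨L, hL⟩ := hM.exists_mul_eq_one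
  rw [← one_mulVec v, ← hL, ← mulVec_mulVec, hv, mulVec_zero]

end BasisCompletion

section KalmanDecomposition

variable {n p r h l : ℕ} {A : Matrix (Fin n) (Fin n) ℝ} {C : Matrix (Fin p) (Fin n) ℝ}

/-- The first block of coordinates is a basis of the row space of the observability matrix, which
is invariant under `A` and contains the rows of `C`. -/
theorem exists_isKalmanObsDecomposition (A : Matrix (Fin n) (Fin n) ℝ)
    (C : Matrix (Fin p) (Fin n) ℝ) :
    ∃ (h l : ℕ) (T : Matrix (Fin n) (Fin h ⊕ Fin l) ℝ) (S : Matrix (Fin h ⊕ Fin l) (Fin n) ℝ)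
      (Ao : Matrix (Fin h) (Fin h) ℝ) (A₂₁ : Matrix (Fin l) (Fin h) ℝ)
      (Au : Matrix (Fin l) (Fin l) ℝ) (Co : Matrix (Fin p) (Fin h) ℝ),
      IsKalmanObsDecomposition A C T S Ao A₂₁ Au Co := by
  obtain ⟨h, Z, hZ⟩ := exists_rowsFormBasis (intrinsicSubspace A C)
  obtain ⟨l, P, hZP⟩ := exists_rowsFormBasis_top hZ.1
  obtain ⟨T, hTS⟩ := hZP.exists_mul_eq_one
  have hcard : Fintype.card (Fin n) = Fintype.card (Fin h ⊕ Fin l) := by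
    rw [← hZP.finrank_eq, finrank_top, Module.finrank_fintype_fun_eq_card]
  have hST : fromRows Z P * T = 1 :=
    (mul_eq_one_comm_of_equiv (Fintype.equivOfCardEq hcard)).1 hTS
  have hZT : Z * T = fromCols 1 0 := by
    rw [fromRows_mul, ← fromBlocks_one, ← fromRows_fromCols_eq_fromBlocks] at hST
    exact (fromRows_ext_iff _ _ _ _).1 hST |>.1
  obtain ⟨Ao, hAo⟩ := hZ.exists_mul_eq
  obtain ⟨Co, hCo⟩ : ∃ Co : Matrix (Fin p) (Fin h) ℝ, C = Co * Z := by
    rw [exists_eq_mul_iff_span_row_le, hZ.2, Submodule.span_le, Set.range_subset_iff]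
    intro i
    simpa using row_mul_pow_mem_intrinsicSubspace (A := A) (F := C) 0 i
  refine ⟨h, l, T, fromRows Z P, Ao, (P * A * T).toCols₁, (P * A * T).toCols₂, Co, hTS, hST,
    ?_, ?_, rank_obsMatrix_eq_iff.2 ((Submodule.eq_bot_iff _).2 fun v hv => ?_)⟩
  · rw [fromRows_mul, fromRows_mul, hAo, Matrix.mul_assoc, hZT, mul_fromCols, Matrix.mul_one,
      Matrix.mul_zero, ← fromRows_fromCols_eq_fromBlocks, fromCols_toCols]
  · rw [hCo, Matrix.mul_assoc, hZT, mul_fromCols, Matrix.mul_one, Matrix.mul_zero]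
  · have hv' : Z *ᵥ (T *ᵥ Sum.elim v 0) = v := by
      rw [mulVec_mulVec, hZT, fromCols_mulVec_sumElim, one_mulVec, mulVec_zero, add_zero]
    rw [← hv', ← mem_unobservableSubspace_mul_iff hAo, ← hCo] at hv
    rw [← hv', hZ.mulVec_eq_zero_of_mem_unobservableSubspace hv]

variable {T : Matrix (Fin n) (Fin h ⊕ Fin l) ℝ} {S : Matrix (Fin h ⊕ Fin l) (Fin n) ℝ}
  {Ao : Matrix (Fin h) (Fin h) ℝ} {A₂₁ : Matrix (Fin l) (Fin h) ℝ} {Au : Matrix (Fin l) (Fin l) ℝ}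
  {Co : Matrix (Fin p) (Fin h) ℝ} {ι : Type}

theorem eq_mul_toRows₁_of_mul_eq_fromCols (hTS : T * S = 1) {M : Matrix ι (Fin n) ℝ}
    {Mo : Matrix ι (Fin h) ℝ} (hM : M * T = fromCols Mo 0) : M = Mo * S.toRows₁ := by
  rw [← Matrix.mul_one M, ← hTS, ← Matrix.mul_assoc, hM]
  conv_lhs => rw [← fromRows_toRows S]
  rw [fromCols_mul_fromRows, Matrix.zero_mul, add_zero]

theorem linearIndependent_row_of_mul_eq_fromCols [Finite ι] (hTS : T * S = 1)
    {M : Matrix ι (Fin n) ℝ} {Mo : Matrix ι (Fin h) ℝ} (hM : M * T = fromCols Mo 0)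
    (hLI : LinearIndependent ℝ M.row) : LinearIndependent ℝ Mo.row := by
  have := Fintype.ofFinite ι
  rw [linearIndependent_row_iff_vecMul] at hLI ⊢
  intro v hv
  refine hLI v ?_
  rw [eq_mul_toRows₁_of_mul_eq_fromCols hTS hM, ← vecMul_vecMul, hv, zero_vecMul]

namespace IsKalmanObsDecomposition

variable (hd : IsKalmanObsDecomposition A C T S Ao A₂₁ Au Co)
include hd

theorem toRows₁_mul : S.toRows₁ * A = Ao * S.toRows₁ := by
  refine eq_mul_toRows₁_of_mul_eq_fromCols hd.mul_inv (Mo := Ao) ?_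
  have hstate := hd.state
  rw [← fromRows_fromCols_eq_fromBlocks] at hstate
  exact congrArg toRows₁ hstate

theorem output_eq : C = Co * S.toRows₁ :=
  eq_mul_toRows₁_of_mul_eq_fromCols hd.mul_inv hd.output

theorem toRows₁_mul_T : S.toRows₁ * T = fromCols 1 0 :=
  congrArg toRows₁ (hd.inv_mul.trans (fromBlocks_one.symm.trans
    (fromRows_fromCols_eq_fromBlocks _ _ _ _).symm))

theorem toRows₁_mul_toCols₁ : S.toRows₁ * T.toCols₁ = 1 :=
  congrArg toCols₁ hd.toRows₁_mul_T

theorem toRows₁_mul_toCols₂ : S.toRows₁ * T.toCols₂ = 0 :=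
  congrArg toCols₂ hd.toRows₁_mul_T

theorem unobservableSubspace_eq_bot : unobservableSubspace Ao Co = ⊥ :=
  rank_obsMatrix_eq_iff.1 hd.observable

theorem le_dim : h ≤ n := by
  have hrank : (S.toRows₁ * T.toCols₁).rank = h := by
    rw [hd.toRows₁_mul_toCols₁, rank_one, Fintype.card_fin]
  exact hrank ▸ (rank_mul_le_left _ _).trans (rank_le_width _)

theorem mul_eq_fromCols {F : Matrix (Fin r) (Fin n) ℝ} (hFO : IsFunctionallyObservable A C F)
    {Fb : Matrix ι (Fin n) ℝ} (hFb : RowsFormBasis Fb (intrinsicSubspace A F)) :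
    Fb * T = fromCols (Fb * T.toCols₁) 0 := by
  have hzero : Fb * T.toCols₂ = 0 := by
    refine Matrix.ext_col fun j => ?_
    refine hFb.mulVec_eq_zero_of_mem_unobservableSubspace (hFO.unobservableSubspace_le ?_)
    rw [hd.output_eq, mem_unobservableSubspace_mul_iff hd.toRows₁_mul]
    have hcol : S.toRows₁ *ᵥ T.toCols₂.col j = 0 := congrArg (·.col j) hd.toRows₁_mul_toCols₂
    exact hcol ▸ Submodule.zero_mem _
  rw [← hzero, ← mul_fromCols, fromCols_toCols]

end IsKalmanObsDecomposition

end KalmanDecomposition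

section FunctionalObserver

variable {n p r h : ℕ} {ι : Type} {A : Matrix (Fin n) (Fin n) ℝ}
  {C : Matrix (Fin p) (Fin n) ℝ} {F : Matrix (Fin r) (Fin n) ℝ} {R : Matrix ι (Fin n) ℝ}
  {Ao : Matrix (Fin h) (Fin h) ℝ} {Co : Matrix (Fin p) (Fin h) ℝ} {Z : Matrix (Fin h) (Fin n) ℝ}

theorem eq_zero_of_observer_pencil_mulVec_eq_zero (hobs : unobservableSubspace A C = ⊥)
    (hinj : ∀ v, F *ᵥ v = 0 → R *ᵥ v = 0 → v = 0) {s : ℂ} {v : Fin n → ℂ}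
    (hF : (s • F.map Complex.ofReal - (F * A).map Complex.ofReal) *ᵥ v = 0)
    (hR : (s • R.map Complex.ofReal - (R * A).map Complex.ofReal) *ᵥ v = 0)
    (hC : C.map Complex.ofReal *ᵥ v = 0) : v = 0 := by
  have hpencil {κ : Type} (M : Matrix κ (Fin n) ℝ) :
      (s • M.map Complex.ofReal - (M * A).map Complex.ofReal) *ᵥ v =
        M.map Complex.ofReal *ᵥ (s • v - A.map Complex.ofReal *ᵥ v) := by
    rw [map_ofReal_mul, sub_mulVec, smul_mulVec, mulVec_sub, mulVec_smul, mulVec_mulVec]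
  rw [hpencil, map_ofReal_mulVec_eq_zero_iff] at hF hR
  have heigen : s • v - A.map Complex.ofReal *ᵥ v = 0 :=
    funext fun i => Complex.ext (congrFun (hinj _ hF.1 hR.1) i) (congrFun (hinj _ hF.2 hR.2) i)
  rw [← unobservableSubspace_map_ofReal_eq_bot_iff, unobservableSubspace_eq_bot_iff_hautus] at hobs
  exact hobs s v (sub_eq_zero.1 heigen).symm hC

theorem observerRankConditions_of_unobservableSubspace_eq_bot [Finite ι]
    (hobs : unobservableSubspace A C = ⊥) (hinj : ∀ v, F *ᵥ v = 0 → R *ᵥ v = 0 → v = 0) :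
    ObserverRankConditions A C F R := by
  have hrank : (fromRows (C * A) (fromRows C (fromRows F R))).rank = n := by
    refine (rank_eq_card_iff_mulVec.2 fun v hv => ?_).trans (Fintype.card_fin n)
    simp only [fromRows_mulVec_eq_zero_iff] at hv
    exact hinj v hv.2.2.1 hv.2.2.2
  refine ⟨?_, fun s => ?_⟩ <;>
    refine (rank_eq_card_iff_mulVec.2 fun v hv => ?_).trans ((Fintype.card_fin n).trans hrank.symm)
  · simp only [fromRows_mulVec_eq_zero_iff] at hv
    exact hinj v hv.2.2.2.2.1 hv.2.2.2.2.2
  · simp only [fromRows_mulVec_eq_zero_iff] at hv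
    exact eq_zero_of_observer_pencil_mulVec_eq_zero hobs hinj hv.1 hv.2.1 hv.2.2.2

theorem observerRankConditions_mul_iff {Y : Matrix (Fin n) (Fin h) ℝ} (hZY : Z * Y = 1)
    (hZ : Z * A = Ao * Z) {Fo : Matrix (Fin r) (Fin h) ℝ} {Ro : Matrix ι (Fin h) ℝ} :
    ObserverRankConditions A (Co * Z) (Fo * Z) (Ro * Z) ↔ ObserverRankConditions Ao Co Fo Ro := by
  have hstate {κ : Type} (M : Matrix κ (Fin h) ℝ) : M * Z * A = M * Ao * Z := by
    rw [Matrix.mul_assoc, hZ, Matrix.mul_assoc]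
  have hZYc : Z.map Complex.ofReal * Y.map Complex.ofReal = 1 := by
    rw [← map_ofReal_mul, hZY]
    exact Matrix.map_one _ Complex.ofReal_zero Complex.ofReal_one
  simp only [ObserverRankConditions, hstate, map_ofReal_mul, ← Matrix.smul_mul, ← Matrix.sub_mul,
    ← fromRows_mul, rank_mul_eq_left_of_mul_eq_one _ hZY, rank_mul_eq_left_of_mul_eq_one _ hZYc]

/-- A Luenberger observer of the quotient system `(Ao, Co)` on which `Fb` lives. -/
theorem exists_isFunctionalObserver_mul (hobs : unobservableSubspace Ao Co = ⊥)
    (hZ : Z * A = Ao * Z) (Fo : Matrix ι (Fin h) ℝ) :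
    ∃ (N : Matrix (Fin h) (Fin h) ℝ) (J : Matrix (Fin h) (Fin p) ℝ) (P : Matrix (Fin h) (Fin n) ℝ)
      (D : Matrix ι (Fin h) ℝ) (E : Matrix ι (Fin p) ℝ),
      ∀ (m : ℕ) (B : Matrix (Fin n) (Fin m) ℝ),
        IsFunctionalObserver A B (Co * Z) (Fo * Z) ⟨N, J, P * B, D, E⟩ := by
  obtain ⟨L, W, hW⟩ := exists_isLyapunovMatrix_sub_mul_output hobs
  refine ⟨Ao - L * Co, L, Z, Fo, 0, fun m B u x w _ hx hw => ?_⟩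
  have herror : Tendsto (fun t => w t - Z *ᵥ x t) atTop (𝓝 0) := by
    refine hW.tendsto_zero (b := fun _ => 0) (fun t ht => ?_) tendsto_const_nhds
    refine ((hw t ht).sub (hasDerivWithinAt_const_mulVec Z (hx t ht))).congr_deriv ?_
    simp only [mulVec_add, mulVec_mulVec, hZ, mulVec_sub, sub_mulVec, Matrix.sub_mul,
      Matrix.mul_assoc, add_zero]
    abel
  refine (tendsto_const_mulVec Fo herror).congr fun t => ?_
  simp only [LinearObserver.estimate, mulVec_sub, mulVec_mulVec, Matrix.zero_mul,
    zero_mulVec, add_zero]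

end FunctionalObserver

section Construction

variable {n p r h l k₁ k₂ : ℕ} {A : Matrix (Fin n) (Fin n) ℝ} {C : Matrix (Fin p) (Fin n) ℝ}
  {F : Matrix (Fin r) (Fin n) ℝ} {R₁ : Matrix (Fin k₁) (Fin n) ℝ}
  {T : Matrix (Fin n) (Fin h ⊕ Fin l) ℝ} {S : Matrix (Fin h ⊕ Fin l) (Fin n) ℝ}
  {Ao : Matrix (Fin h) (Fin h) ℝ} {A₂₁ : Matrix (Fin l) (Fin h) ℝ} {Au : Matrix (Fin l) (Fin l) ℝ}
  {Co : Matrix (Fin p) (Fin h) ℝ} {Fo : Matrix (Fin r ⊕ Fin k₁) (Fin h) ℝ}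
  {Fp : Matrix (Fin k₂) (Fin h) ℝ}

theorem IsRowBasisCompletion.rowsFormBasis (hR : IsRowBasisCompletion A F R₁) :
    RowsFormBasis (fromRows F R₁) (intrinsicSubspace A F) :=
  intrinsicSubspace_eq_span_row (A := A) (F := F) ▸ hR.2

theorem RowsFormBasis.eq_add_of_top (hFp : RowsFormBasis (fromRows Fo Fp) ⊤) :
    h = r + (k₁ + k₂) := by
  have hcard := hFp.finrank_eq
  rw [finrank_top, Module.finrank_fintype_fun_eq_card] at hcard
  simpa only [Fintype.card_sum, Fintype.card_fin, add_assoc] using hcard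

namespace IsKalmanObsDecomposition

variable (hd : IsKalmanObsDecomposition A C T S Ao A₂₁ Au Co)
include hd

theorem add_le (hFp : RowsFormBasis (fromRows Fo Fp) ⊤) : r + (k₁ + k₂) ≤ n :=
  hFp.eq_add_of_top ▸ hd.le_dim

theorem observerRankConditions (hFo : fromRows F R₁ * T = fromCols Fo 0)
    (hFp : RowsFormBasis (fromRows Fo Fp) ⊤) :
    ObserverRankConditions A C F (fromRows R₁ (fromCols Fp (0 : Matrix _ (Fin l) ℝ) * S)) := by
  have hFb := eq_mul_toRows₁_of_mul_eq_fromCols hd.mul_inv hFo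
  have hF : F = Fo.toRows₁ * S.toRows₁ := congrArg toRows₁ hFb
  have hR₁ : R₁ = Fo.toRows₂ * S.toRows₁ := congrArg toRows₂ hFb
  have hR₂ : fromCols Fp (0 : Matrix _ (Fin l) ℝ) * S = Fp * S.toRows₁ := by
    refine eq_mul_toRows₁_of_mul_eq_fromCols hd.mul_inv (T := T) ?_
    rw [Matrix.mul_assoc, hd.inv_mul, Matrix.mul_one]
  rw [hd.output_eq, hF, hR₁, hR₂, ← fromRows_mul,
    observerRankConditions_mul_iff hd.toRows₁_mul_toCols₁ hd.toRows₁_mul]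
  refine observerRankConditions_of_unobservableSubspace_eq_bot hd.unobservableSubspace_eq_bot
    fun v hv₁ hv₂ => hFp.eq_zero_of_mulVec_eq_zero ?_
  rw [fromRows_mulVec_eq_zero_iff] at hv₂
  rw [← fromRows_toRows Fo, fromRows_mulVec_eq_zero_iff, fromRows_mulVec_eq_zero_iff]
  exact ⟨⟨hv₁, hv₂.1⟩, hv₂.2⟩

theorem exists_isFunctionalObserver (hFo : fromRows F R₁ * T = fromCols Fo 0)
    (hFp : RowsFormBasis (fromRows Fo Fp) ⊤) :
    ∃ (N : Matrix (Fin (r + (k₁ + k₂))) (Fin (r + (k₁ + k₂))) ℝ)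
      (J : Matrix (Fin (r + (k₁ + k₂))) (Fin p) ℝ) (P : Matrix (Fin (r + (k₁ + k₂))) (Fin n) ℝ)
      (D : Matrix (Fin r ⊕ Fin k₁) (Fin (r + (k₁ + k₂))) ℝ)
      (E : Matrix (Fin r ⊕ Fin k₁) (Fin p) ℝ),
      ∀ (m : ℕ) (B : Matrix (Fin n) (Fin m) ℝ),
        IsFunctionalObserver A B C (fromRows F R₁) ⟨N, J, P * B, D, E⟩ := by
  obtain rfl := hFp.eq_add_of_top
  rw [eq_mul_toRows₁_of_mul_eq_fromCols hd.mul_inv hFo, hd.output_eq]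
  exact exists_isFunctionalObserver_mul hd.unobservableSubspace_eq_bot hd.toRows₁_mul Fo

end IsKalmanObsDecomposition

end Construction

end GSP

/-- Generalized separation principle, with its constructive form. -/
theorem mainTheorem12 {n m p r : ℕ} (A : Matrix (Fin n) (Fin n) ℝ)
    (B : Matrix (Fin n) (Fin m) ℝ) (C : Matrix (Fin p) (Fin n) ℝ) (F : Matrix (Fin r) (Fin n) ℝ)
    (hF : F.rank = r) (hIFC : IsIntrinsicallyFunctionallyControllable A B F)
    (hFO : IsFunctionallyObservable A C F) :
    -- the augmentations exist, and satisfy all four rank conditions simultaneously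
    (∃ (k₁ k₂ : ℕ) (R₁ : Matrix (Fin k₁) (Fin n) ℝ) (R₂ : Matrix (Fin k₂) (Fin n) ℝ),
      r + (k₁ + k₂) ≤ n ∧ (fromRows F R₁).rank = r + k₁ ∧
      ControllerRankConditions A B (fromRows F R₁) ∧
      ObserverRankConditions A C F (fromRows R₁ R₂)) ∧
    -- the ingredients of the explicit construction exist
    (∃ (k₁ : ℕ) (R₁ : Matrix (Fin k₁) (Fin n) ℝ), IsRowBasisCompletion A F R₁) ∧
    (∃ (h l : ℕ) (T : Matrix (Fin n) (Fin h ⊕ Fin l) ℝ) (S : Matrix (Fin h ⊕ Fin l) (Fin n) ℝ)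
      (Ao : Matrix (Fin h) (Fin h) ℝ) (A₂₁ : Matrix (Fin l) (Fin h) ℝ)
      (Au : Matrix (Fin l) (Fin l) ℝ) (Co : Matrix (Fin p) (Fin h) ℝ),
      IsKalmanObsDecomposition A C T S Ao A₂₁ Au Co) ∧
    -- and every choice of them works
    (∀ (k₁ : ℕ) (R₁ : Matrix (Fin k₁) (Fin n) ℝ), IsRowBasisCompletion A F R₁ →
      ((fromRows F R₁).rank = r + k₁ ∧ Module.finrank ℝ (intrinsicSubspace A F) = r + k₁ ∧
        LinearMap.range (fromRows F R₁)ᵀ.mulVecLin = intrinsicSubspace A F ∧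
        ControllerRankConditions A B (fromRows F R₁)) ∧
      (∀ (h l : ℕ) (T : Matrix (Fin n) (Fin h ⊕ Fin l) ℝ)
        (S : Matrix (Fin h ⊕ Fin l) (Fin n) ℝ)
        (Ao : Matrix (Fin h) (Fin h) ℝ) (A₂₁ : Matrix (Fin l) (Fin h) ℝ)
        (Au : Matrix (Fin l) (Fin l) ℝ) (Co : Matrix (Fin p) (Fin h) ℝ),
        IsKalmanObsDecomposition A C T S Ao A₂₁ Au Co →
        ∃ Fo : Matrix (Fin r ⊕ Fin k₁) (Fin h) ℝ,
          fromRows F R₁ * T = fromCols Fo 0 ∧ Fo.rank = r + k₁ ∧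
          (∃ (k₂ : ℕ) (Fp : Matrix (Fin k₂) (Fin h) ℝ), RowsFormBasis (fromRows Fo Fp) ⊤) ∧
          ∀ (k₂ : ℕ) (Fp : Matrix (Fin k₂) (Fin h) ℝ), RowsFormBasis (fromRows Fo Fp) ⊤ →
            r + (k₁ + k₂) ≤ n ∧
            ObserverRankConditions A C F (fromRows R₁ (fromCols Fp 0 * S)) ∧
            -- a functional observer of order `r + k₁ + k₂`, whose design does not use `B`:
            -- the input matrix enters through its input channel `P * B'` only
            ∃ (N : Matrix (Fin (r + (k₁ + k₂))) (Fin (r + (k₁ + k₂))) ℝ)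
              (J : Matrix (Fin (r + (k₁ + k₂))) (Fin p) ℝ)
              (P : Matrix (Fin (r + (k₁ + k₂))) (Fin n) ℝ)
              (D : Matrix (Fin r ⊕ Fin k₁) (Fin (r + (k₁ + k₂))) ℝ)
              (E : Matrix (Fin r ⊕ Fin k₁) (Fin p) ℝ),
              ∀ (m' : ℕ) (B' : Matrix (Fin n) (Fin m') ℝ),
                IsFunctionalObserver A B' C (fromRows F R₁) ⟨N, J, P * B', D, E⟩) ∧
      -- a controller gain exists, whose design does not use `C`
      (∃ K : Matrix (Fin m) (Fin r ⊕ Fin k₁) ℝ,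
        IsFunctionalController A B (fromRows F R₁) K) ∧
      -- every controller gain can be combined with every functional observer
      (∀ (K : Matrix (Fin m) (Fin r ⊕ Fin k₁) ℝ) (q : ℕ)
        (O : LinearObserver q p m (Fin r ⊕ Fin k₁)),
        IsFunctionalController A B (fromRows F R₁) K →
        IsFunctionalObserver A B C (fromRows F R₁) O →
        (∀ (x₀ : Fin n → ℝ) (w₀ : Fin q → ℝ), ∃ (x : ℝ → Fin n → ℝ) (w : ℝ → Fin q → ℝ),
          x 0 = x₀ ∧ w 0 = w₀ ∧ IsClosedLoopSolution A B C K O x w) ∧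
        ∀ (x : ℝ → Fin n → ℝ) (w : ℝ → Fin q → ℝ), IsClosedLoopSolution A B C K O x w →
          Tendsto (fun t => F *ᵥ x t) atTop (𝓝 0))) := by
  have hFrow : LinearIndependent ℝ F.row :=
    rank_eq_card_iff_linearIndependent_row.1 (hF.trans (Fintype.card_fin r).symm)
  have hcompletion := exists_isRowBasisCompletion A hFrow
  have hkalman := exists_isKalmanObsDecomposition A C
  refine ⟨?_, hcompletion, hkalman, fun k₁ R₁ hR => ?_⟩
  · obtain ⟨k₁, R₁, hR⟩ := hcompletion
    obtain ⟨h, l, T, S, Ao, A₂₁, Au, Co, hd⟩ := hkalman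
    have hFo := hd.mul_eq_fromCols hFO hR.rowsFormBasis
    obtain ⟨k₂, Fp, hFp⟩ := exists_rowsFormBasis_top
      (linearIndependent_row_of_mul_eq_fromCols hd.mul_inv hFo hR.2.1)
    exact ⟨k₁, k₂, R₁, _, hd.add_le hFp, rank_eq_add_of_linearIndependent_row hR.2.1,
      hR.rowsFormBasis.controllerRankConditions hIFC, hd.observerRankConditions hFo hFp⟩
  have hFb := hR.rowsFormBasis
  have hctrl := hFb.controllerRankConditions hIFC
  refine ⟨⟨rank_eq_add_of_linearIndependent_row hFb.1, ?_, hFb.range_mulVecLin_transpose, hctrl⟩,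
    fun h l T S Ao A₂₁ Au Co hd => ?_, exists_isFunctionalController hFb.1 hctrl, fun K q O hK hO =>
      ⟨exists_isClosedLoopSolution A B C K O, fun x w hxw => ?_⟩⟩
  · simpa only [Fintype.card_sum, Fintype.card_fin] using hFb.finrank_eq
  · have hFo := hd.mul_eq_fromCols hFO hFb
    have hFoRow := linearIndependent_row_of_mul_eq_fromCols hd.mul_inv hFo hFb.1
    exact ⟨_, hFo, rank_eq_add_of_linearIndependent_row hFoRow, exists_rowsFormBasis_top hFoRow,
      fun k₂ Fp hFp => ⟨hd.add_le hFp, hd.observerRankConditions hFo hFp,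
        hd.exists_isFunctionalObserver hFo hFp⟩⟩
  · obtain ⟨M, hM⟩ := hFb.exists_mul_eq
    have hFbx := tendsto_zero_of_isClosedLoopSolution hM hFb.1 hK hO hxw
    exact tendsto_pi_nhds.2 fun i => tendsto_pi_nhds.1 hFbx (Sum.inl i)
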